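/- In the budgeted $\ell$-matchoid problem (BM), an instance $I=(E,\mathcal M,c,p,B,k,\ell)$ consists of a finite ground set $E$, a collection $\mathcal M=\{(E_i,\mathcal I_i)\}_{i\in[s]}$ of matroids with $E_i\subseteq E$ such that every $e\in E$ lies in at most $\ell$ of the sets $E_1,\dots,E_s$, a cost function $c:E\to\mathbb N_{>0}$, a profit function $p:E\to\mathbb N_{>0}$, a budget $B\in\mathbb N_{>0}$ and parameters $k,\ell\in\mathbb N_{>0}$. The matroids are accessed through membership oracles: one query tells whether a given subset of $E_i$ belongs to $\mathcal I_i$. A solution of $I$ is a set $S\subseteq E$ with $S\cap E_i\in\mathcal I_i$ for all $i\in[s]$, $|S|\le k$ and $c(S)=\sum_{e\in S}c(e)\le B$; $\mathrm{OPT}(I)$ is the maximum of $p(S)=\sum_{e\in S}p(e)$ over all solutions $S$. For $0<\varepsilon<\frac12$, a set $R\subseteq E$ is a representative set of $I$ and $\varepsilon$ if there is a solution $S$ of $I$ with $S\subseteq R$ and $p(S)\ge(1-2\varepsilon)\cdot\mathrm{OPT}(I)$. Let $|I|$ denote the encoding size of $I$ (without the oracles), and let $\tilde O(f)$ stand for $O(f\cdot\mathrm{poly}(\log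 f))$. **Lemma.** There is an algorithm that, given a BM instance $I=(E,\mathcal M,c,p,B,k,\ell)$ and a rational $0<\varepsilon<\frac12$, returns in time $|I|^{O(1)}$ a representative set $R\subseteq E$ of $I$ and $\varepsilon$ such that $$|R|=\tilde O\left(\ell^{(k-1)\cdot\ell}\cdot k^2\cdot\varepsilon^{-2}\right).$$ The constants hidden in $|I|^{O(1)}$ and in $\tilde O$ are absolute, i.e. they do not depend on $I$ (in particular not on $k$ and $\ell$) or on $\varepsilon$. Time is counted on a random access machine with unit-cost addition, truncated subtraction, memory access and oracle queries. -/

import Mathlib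

/-! ### Random access machines with an independence oracle

The machine has integer registers and integer arrays (all cells hold natural numbers), and the
only arithmetic operations are addition and truncated subtraction.  Every elementary operation,
memory access and oracle query costs one unit.  Since there is no multiplication or shift, an
operation lengthens the numbers by at most one bit, so that this uniform cost measure is
polynomially equivalent to Turing machine time. -/

namespace RAM

/-- The memory: `reg x` is the content of register `x`, and `arr a j` is the `j`-th cell of the
array with name `a`. -/
structure State where
  reg : ℕ → ℕ
  arr : ℕ → ℕ → ℕ

/-- Write the value `v` into register `x`. -/
def State.setReg (σ : State) (x v : ℕ) : State :=
  { σ with reg := Function.update σ.reg x v }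

/-- Write the value `v` into cell `j` of array `a`. -/
def State.setArr (σ : State) (a j v : ℕ) : State :=
  { σ with arr := Function.update σ.arr a (Function.update (σ.arr a) j v) }

/-- Arithmetic expressions: constants, registers, array cells, sums, truncated differences. -/
inductive Expr where
  | const (c : ℕ)
  | var (x : ℕ)
  | get (a : ℕ) (j : Expr)
  | plus (e f : Expr)
  | minus (e f : Expr)

/-- The value of an expression. -/
def Expr.eval (σ : State) : Expr → ℕ
  | const c => c
  | var x => σ.reg x
  | get a j => σ.arr a (j.eval σ)
  | plus e f => e.eval σ + f.eval σ
  | minus e f => e.eval σ - f.eval σ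

/-- The cost of evaluating an expression: one unit for every operation in it. -/
def Expr.cost : Expr → ℕ
  | const _ => 1
  | var _ => 1
  | get _ j => j.cost + 1
  | plus e f => e.cost + f.cost + 1
  | minus e f => e.cost + f.cost + 1

/-- Programs.  A test `e` succeeds when the value of `e` is not `0`. -/
inductive Prog where
  /-- Do nothing. -/
  | skip
  /-- `reg x := e` -/
  | assign (x : ℕ) (e : Expr)
  /-- `arr a j := e` -/
  | store (a : ℕ) (j e : Expr)
  /-- Ask the `i`-th oracle about the set `{j | arr a j ≠ 0}`; the answer, `1` for yes and `0`
  for no, goes to register `x`. -/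
  | query (x : ℕ) (i : Expr) (a : ℕ)
  /-- Run `P`, then `Q`. -/
  | seq (P Q : Prog)
  /-- Run `P` if the test `e` succeeds, and `Q` otherwise. -/
  | cond (e : Expr) (P Q : Prog)
  /-- Run `P` as long as the test `e` succeeds. -/
  | loop (e : Expr) (P : Prog)

/-- `Exec O P σ t τ`: with the oracles `O`, the program `P` started in the memory state `σ` halts
after `t` elementary steps in the memory state `τ`. -/
inductive Exec (O : ℕ → Set ℕ → Prop) : Prog → State → ℕ → State → Prop where
  | skip (σ : State) : Exec O .skip σ 1 σ
  | assign (x : ℕ) (e : Expr) (σ : State) :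
      Exec O (.assign x e) σ (e.cost + 1) (σ.setReg x (e.eval σ))
  | store (a : ℕ) (j e : Expr) (σ : State) :
      Exec O (.store a j e) σ (j.cost + e.cost + 1) (σ.setArr a (j.eval σ) (e.eval σ))
  | query_yes (x : ℕ) (i : Expr) (a : ℕ) (σ : State) (h : O (i.eval σ) {j | σ.arr a j ≠ 0}) :
      Exec O (.query x i a) σ (i.cost + 1) (σ.setReg x 1)
  | query_no (x : ℕ) (i : Expr) (a : ℕ) (σ : State) (h : ¬ O (i.eval σ) {j | σ.arr a j ≠ 0}) :
      Exec O (.query x i a) σ (i.cost + 1) (σ.setReg x 0)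
  | seq (P Q : Prog) (σ τ ρ : State) (t u : ℕ) (hP : Exec O P σ t τ) (hQ : Exec O Q τ u ρ) :
      Exec O (.seq P Q) σ (t + u) ρ
  | cond_true (e : Expr) (P Q : Prog) (σ τ : State) (t : ℕ) (he : e.eval σ ≠ 0)
      (hP : Exec O P σ t τ) : Exec O (.cond e P Q) σ (e.cost + 1 + t) τ
  | cond_false (e : Expr) (P Q : Prog) (σ τ : State) (t : ℕ) (he : e.eval σ = 0)
      (hQ : Exec O Q σ t τ) : Exec O (.cond e P Q) σ (e.cost + 1 + t) τ
  | loop_true (e : Expr) (P : Prog) (σ τ ρ : State) (t u : ℕ) (he : e.eval σ ≠ 0)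
      (hP : Exec O P σ t τ) (hL : Exec O (.loop e P) τ u ρ) :
      Exec O (.loop e P) σ (e.cost + 1 + t + u) ρ
  | loop_false (e : Expr) (P : Prog) (σ : State) (he : e.eval σ = 0) :
      Exec O (.loop e P) σ (e.cost + 1) σ

end RAM

/-! ### The budgeted matchoid problem -/

/-- An instance of the budgeted `ℓ`-matchoid problem.  The elements of the ground set are
numbered, so that it is `Fin n`, and the `ℓ`-matchoid is the family of matroids
`M 0, …, M (s - 1)`, the `i`-th of which has the ground set `(M i).E`. -/
structure BMInstance where
  /-- The number of elements. -/
  n : ℕ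
  /-- The number of matroids. -/
  s : ℕ
  M : Fin s → Matroid (Fin n)
  cost : Fin n → ℕ
  profit : Fin n → ℕ
  budget : ℕ
  k : ℕ
  ℓ : ℕ
  cost_pos : ∀ e, 0 < cost e
  profit_pos : ∀ e, 0 < profit e
  budget_pos : 0 < budget
  k_pos : 0 < k
  ℓ_pos : 0 < ℓ
  matchoid : ∀ e : Fin n, {i : Fin s | e ∈ (M i).E}.ncard ≤ ℓ

namespace BMInstance

/-- `S` is feasible for the matchoid: its trace on the ground set of each matroid is
independent. -/
def Feasible (I : BMInstance) (S : Finset (Fin I.n)) : Prop :=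
  ∀ i, (I.M i).Indep ((S : Set (Fin I.n)) ∩ (I.M i).E)

/-- A solution: a feasible set of at most `k` elements whose cost is within the budget. -/
def IsSolution (I : BMInstance) (S : Finset (Fin I.n)) : Prop :=
  I.Feasible S ∧ S.card ≤ I.k ∧ ∑ e ∈ S, I.cost e ≤ I.budget

open Classical in
/-- The maximum profit of a solution. -/
noncomputable def OPT (I : BMInstance) : ℕ :=
  ((Finset.univ : Finset (Finset (Fin I.n))).filter I.IsSolution).sup fun S => ∑ e ∈ S, I.profit e

/-- `R` is a representative set of `I` and `ε`. -/
def IsRepresentative (I : BMInstance) (ε : ℝ) (R : Finset (Fin I.n)) : Prop :=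
  ∃ S : Finset (Fin I.n), I.IsSolution S ∧ S ⊆ R ∧
    (1 - 2 * ε) * (I.OPT : ℝ) ≤ ((∑ e ∈ S, I.profit e : ℕ) : ℝ)

/-- The quantity `ℓ ^ ((k - 1) ℓ) * k ^ 2 * ε ^ (-2)`. -/
noncomputable def sizeBound (I : BMInstance) (ε : ℝ) : ℝ :=
  (I.ℓ : ℝ) ^ ((I.k - 1) * I.ℓ) * (I.k : ℝ) ^ 2 * ε⁻¹ ^ 2

/-- The encoding size of an instance: the numbers of elements and matroids, one bit for each pair
of an element and a matroid, and the binary lengths of all costs, all profits, the budget, `k`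
and `ℓ`. -/
def size (I : BMInstance) : ℕ :=
  I.n + I.s + I.n * I.s + ∑ e, (Nat.size (I.cost e) + Nat.size (I.profit e)) +
    Nat.size I.budget + Nat.size I.k + Nat.size I.ℓ

/-- The membership oracles: the `i`-th one tells whether a set of elements, given by their
numbers, is independent in `M i`. -/
def oracle (I : BMInstance) (i : ℕ) (S : Set ℕ) : Prop :=
  ∃ h : i < I.s, (I.M ⟨i, h⟩).Indep {e : Fin I.n | (e : ℕ) ∈ S}

open Classical in
/-- The memory at the start of a computation on the input `(I, ε)`.  Registers `0` to `6` hold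
`n`, `s`, `k`, `ℓ`, the budget, and the numerator and the denominator of `ε`; arrays `0` and `1`
hold the costs and the profits; array `2` is the incidence table of elements and matroids, row by
row: its cell `e * s + i` is `1` if `e` belongs to the ground set of `M i`, and `0` otherwise.
Everything else is `0`. -/
noncomputable def input (I : BMInstance) (ε : ℚ) : RAM.State where
  reg x := match x with
    | 0 => I.n
    | 1 => I.s
    | 2 => I.k
    | 3 => I.ℓ
    | 4 => I.budget
    | 5 => ε.num.toNat
    | 6 => ε.den
    | _ => 0
  arr a j := match a with
    | 0 => if h : j < I.n then I.cost ⟨j, h⟩ else 0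
    | 1 => if h : j < I.n then I.profit ⟨j, h⟩ else 0
    | 2 => if ∃ (e : Fin I.n) (i : Fin I.s), j = e * I.s + i ∧ e ∈ (I.M i).E then 1 else 0
    | _ => 0

/-- The set of elements that a computation outputs: it is read off from array `3`. -/
def output (I : BMInstance) (σ : RAM.State) : Finset (Fin I.n) :=
  Finset.univ.filter fun e => σ.arr 3 e ≠ 0

end BMInstance

/-! ### Weakest preconditions and running times for machine programs. -/

namespace RAM

/-! Let `m = ⌊1/ε⌋`, `K = k * m`, `D = (k - 1) * ℓ`, and let `W` be the largest profit of a
one-element solution. The elements of solutions fall into `K + 1` profit classes: class `j` asks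
that `K` times the profit lie in `[jW, (j + 1)W)`. It suffices to find a set `R` with an exchange
property: if `e` lies in a solution `S` but not in `R`, and `T = S \ {e}`, then some `x ∈ R` of the
class of `e` is no more expensive than `e` and can be added to `T`. Replacing `e` by `x` then costs
less than `W / K` in profit. At most `k` exchanges lose at most `W / m ≤ OPT / m ≤ 2ε OPT`
(`IsSolution.exists_subset`, `isRepresentative_of_chosen`).

Such an `x` is found by a search tree for each class. A node holds an independent set for every
matroid, initially empty. It chooses the cheapest element `x` of the class that is new and extends
the sets of all matroids containing it; its children put `x` into the set of one of these at most
`ℓ` matroids. Given `T` and `e`, consider the nodes whose sets are spanned by `T` in their matroids.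
At such a node `e` itself is eligible, so `x` exists and is no more expensive. Either `x` can be
added to `T`, or `T` spans `x` in some matroid, and the corresponding child is again spanned by `T`.
The second case can occur at most `D` times: independent sets spanned by `T` have total size at most
`∑ i, |T ∩ E i| ≤ (k - 1) * ℓ` (`SpannedBy.card_le`). So an admissible `x` appears within `D + 1`
steps of some branch (`SpannedBy.exists_branch`).

Branches are numbered by `D` digits to the base `ℓ`, so at most `(K + 1) * ℓ ^ D * (D + 1)` elements
are chosen. The factor `D + 1` is absorbed by a logarithm if `ℓ ≥ 2`, and equals `k` if `ℓ = 1`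
(`mul_pow_mul_le`).

The tree is searched only if `m`, `k`, `D` and `ℓ ^ D` are all less than `n`; otherwise the whole
ground set is small enough to be output (`card_le_of_exit`). Hence every loop has at most `|I| ^ 2`
rounds (`wp_algorithm`), and a fixed program with this property runs in polynomial time
(`exec_of_wp`, `Prog.exists_time_le_pow`). -/

@[simp] theorem State.setReg_reg (σ : State) (x v y : ℕ) :
    (σ.setReg x v).reg y = if y = x then v else σ.reg y := by
  simp [State.setReg, Function.update_apply]

@[simp] theorem State.setReg_arr (σ : State) (x v : ℕ) : (σ.setReg x v).arr = σ.arr := rfl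

@[simp] theorem State.setArr_reg (σ : State) (a j v : ℕ) : (σ.setArr a j v).reg = σ.reg := rfl

@[simp] theorem State.setArr_arr (σ : State) (a j v b : ℕ) :
    (σ.setArr a j v).arr b = if b = a then Function.update (σ.arr a) j v else σ.arr b := by
  simp [State.setArr, Function.update_apply]

/-- The test `e < f`. -/
abbrev Expr.lt (e f : Expr) : Expr := .minus f e

/-- The test `e ≤ f`. -/
abbrev Expr.le (e f : Expr) : Expr := .minus (.plus f (.const 1)) e

/-- The test `e = f`. -/
abbrev Expr.eq (e f : Expr) : Expr := .minus (.const 1) (.plus (.minus e f) (.minus f e))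

/-- Whether a program contains an instruction that writes into register `x`. -/
def Prog.writesReg : Prog → ℕ → Bool
  | skip, _ => false
  | assign y _, x => x == y
  | store _ _ _, _ => false
  | query y _ _, x => x == y
  | seq P Q, x => P.writesReg x || Q.writesReg x
  | cond _ P Q, x => P.writesReg x || Q.writesReg x
  | loop _ P, x => P.writesReg x

/-- Whether a program contains an instruction that writes into array `a`. -/
def Prog.writesArr : Prog → ℕ → Bool
  | skip, _ => false
  | assign _ _, _ => false
  | store b _ _, a => a == b
  | query _ _ _, _ => false
  | seq P Q, a => P.writesArr a || Q.writesArr a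
  | cond _ P Q, a => P.writesArr a || Q.writesArr a
  | loop _ P, a => P.writesArr a

/-- The states `σ` and `τ` agree on everything that `P` does not write. -/
structure Frame (P : Prog) (σ τ : State) : Prop where
  reg : ∀ x, P.writesReg x = false → τ.reg x = σ.reg x
  arr : ∀ a, P.writesArr a = false → τ.arr a = σ.arr a

theorem Frame.refl (P : Prog) (σ : State) : Frame P σ σ := ⟨fun _ _ => rfl, fun _ _ => rfl⟩

theorem Frame.trans {P : Prog} {σ τ ρ : State} (h : Frame P σ τ) (h' : Frame P τ ρ) :
    Frame P σ ρ :=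
  ⟨fun x hx => (h'.reg x hx).trans (h.reg x hx), fun a ha => (h'.arr a ha).trans (h.arr a ha)⟩

theorem Frame.mono {P Q : Prog} {σ τ : State} (h : Frame P σ τ)
    (hr : ∀ x, Q.writesReg x = false → P.writesReg x = false)
    (ha : ∀ a, Q.writesArr a = false → P.writesArr a = false) : Frame Q σ τ :=
  ⟨fun x hx => h.reg x (hr x hx), fun a hx => h.arr a (ha a hx)⟩

/-- The weakest precondition of a loop with at most `m` rounds. -/
def loopWp (e : Expr) (W : (State → Prop) → State → Prop) (Q : State → Prop) :
    ℕ → State → Prop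
  | 0 => fun σ => e.eval σ = 0 ∧ Q σ
  | m + 1 => fun σ => (e.eval σ = 0 ∧ Q σ) ∨ (e.eval σ ≠ 0 ∧ W (loopWp e W Q m) σ)

/-- The weakest precondition for `P` to halt in a state satisfying `Q`, where each run of a loop
has at most `N` rounds. -/
def wp (O : ℕ → Set ℕ → Prop) (N : ℕ) : Prog → (State → Prop) → State → Prop
  | .skip, Q => Q
  | .assign x e, Q => fun σ => Q (σ.setReg x (e.eval σ))
  | .store a j e, Q => fun σ => Q (σ.setArr a (j.eval σ) (e.eval σ))
  | .query x i a, Q => fun σ =>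
      (O (i.eval σ) {j | σ.arr a j ≠ 0} → Q (σ.setReg x 1)) ∧
        (¬ O (i.eval σ) {j | σ.arr a j ≠ 0} → Q (σ.setReg x 0))
  | .seq P R, Q => wp O N P (wp O N R Q)
  | .cond e P R, Q => fun σ => (e.eval σ ≠ 0 → wp O N P Q σ) ∧ (e.eval σ = 0 → wp O N R Q σ)
  | .loop e P, Q => loopWp e (wp O N P) Q N

/-- A bound for the running time when each run of a loop has at most `N` rounds. -/
def Prog.time (N : ℕ) : Prog → ℕ
  | skip => 1
  | assign _ e => e.cost + 1
  | store _ j e => j.cost + e.cost + 1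
  | query _ i _ => i.cost + 1
  | seq P Q => P.time N + Q.time N
  | cond e P Q => e.cost + 1 + (P.time N + Q.time N)
  | loop e P => N * (e.cost + 1 + P.time N) + (e.cost + 1)

theorem le_pow_self_of_two_le {a N : ℕ} (hN : 2 ≤ N) : a ≤ N ^ a :=
  (Nat.lt_two_pow_self).le.trans (Nat.pow_le_pow_left hN a)

theorem add_pow_le_pow {a b N : ℕ} (hN : 2 ≤ N) : N ^ a + N ^ b ≤ N ^ (a + b + 1) := by
  have h1 : N ^ a ≤ N ^ (a + b) := Nat.pow_le_pow_right (by omega) (by omega)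
  have h2 : N ^ b ≤ N ^ (a + b) := Nat.pow_le_pow_right (by omega) (by omega)
  calc N ^ a + N ^ b ≤ N ^ (a + b) * 2 := by omega
    _ ≤ N ^ (a + b) * N := Nat.mul_le_mul_left _ hN
    _ = N ^ (a + b + 1) := (pow_succ _ _).symm

/-- Each loop multiplies the time by about `N`, and constants are absorbed because `a ≤ N ^ a` for
`N ≥ 2`. The exponent depends on the program alone, which makes the final time bound absolute. -/
theorem Prog.exists_time_le_pow (P : Prog) : ∃ c, ∀ N, 2 ≤ N → P.time N ≤ N ^ c := by
  induction P with
  | skip => exact ⟨0, fun N _ => by simp [Prog.time]⟩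
  | assign x e => exact ⟨_, fun N hN => le_pow_self_of_two_le hN⟩
  | store a j e => exact ⟨_, fun N hN => le_pow_self_of_two_le hN⟩
  | query x i a => exact ⟨_, fun N hN => le_pow_self_of_two_le hN⟩
  | seq P Q hP hQ =>
    obtain ⟨a, ha⟩ := hP
    obtain ⟨b, hb⟩ := hQ
    exact ⟨a + b + 1, fun N hN => (Nat.add_le_add (ha N hN) (hb N hN)).trans (add_pow_le_pow hN)⟩
  | cond e P Q hP hQ =>
    obtain ⟨a, ha⟩ := hP
    obtain ⟨b, hb⟩ := hQ
    exact ⟨_, fun N hN => (Nat.add_le_add (le_pow_self_of_two_le hN)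
      ((Nat.add_le_add (ha N hN) (hb N hN)).trans (add_pow_le_pow hN))).trans
        (add_pow_le_pow hN)⟩
  | loop e P hP =>
    obtain ⟨a, ha⟩ := hP
    refine ⟨(e.cost + 1 + a + 1 + 1) + (e.cost + 1) + 1, fun N hN =>
      (Nat.add_le_add ?_ (le_pow_self_of_two_le hN)).trans (add_pow_le_pow hN)⟩
    · rw [pow_succ' N (_ + 1)]
      exact Nat.mul_le_mul_left _ ((Nat.add_le_add (le_pow_self_of_two_le hN) (ha N hN)).trans
        (add_pow_le_pow hN))

/-- The rule of consequence combined with the frame rule: specifications need to mention only what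
changes, and everything else is recovered from the syntax of the program. -/
theorem wp_frame {O : ℕ → Set ℕ → Prop} {N : ℕ} {P : Prog} {Q R : State → Prop} {σ : State}
    (h : wp O N P Q σ) (hR : ∀ τ, Frame P σ τ → Q τ → R τ) : wp O N P R σ := by
  induction P generalizing Q R σ with
  | skip => exact hR _ (Frame.refl _ _) h
  | assign x e =>
    refine hR _ ⟨fun y hy => ?_, fun a _ => rfl⟩ h
    have : y ≠ x := by simpa [Prog.writesReg] using hy
    simp [this]
  | store a j e =>
    refine hR _ ⟨fun y hy => rfl, fun b hb => ?_⟩ h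
    have : b ≠ a := by simpa [Prog.writesArr] using hb
    simp [this]
  | query x i a =>
    have key : ∀ v, Frame (.query x i a) σ (σ.setReg x v) := by
      refine fun v => ⟨fun y hy => ?_, fun a _ => rfl⟩
      have : y ≠ x := by simpa [Prog.writesReg] using hy
      simp [this]
    exact ⟨fun ho => hR _ (key _) (h.1 ho), fun ho => hR _ (key _) (h.2 ho)⟩
  | seq P P' hP hP' =>
    refine hP (Q := wp O N P' Q) h fun τ hτ hτ' => hP' hτ' fun ρ hρ hQ => hR ρ ?_ hQ
    refine (hτ.mono ?_ ?_).trans (hρ.mono ?_ ?_) <;> simp [Prog.writesReg, Prog.writesArr] <;>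
      tauto
  | cond e P P' hP hP' =>
    refine ⟨fun he => hP (h.1 he) fun τ hτ => hR τ (hτ.mono ?_ ?_),
      fun he => hP' (h.2 he) fun τ hτ => hR τ (hτ.mono ?_ ?_)⟩ <;>
      simp [Prog.writesReg, Prog.writesArr] <;> tauto
  | loop e P hP =>
    have key : ∀ m (σ : State), loopWp e (wp O N P) Q m σ →
        (∀ τ, Frame (.loop e P) σ τ → Q τ → R τ) → loopWp e (wp O N P) R m σ := by
      intro m
      induction m with
      | zero => exact fun σ h hR => ⟨h.1, hR σ (Frame.refl _ _) h.2⟩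
      | succ m ih =>
        rintro σ (h | h) hR
        · exact Or.inl ⟨h.1, hR σ (Frame.refl _ _) h.2⟩
        · refine Or.inr ⟨h.1, hP h.2 fun τ hτ hm => ih τ hm fun ρ hρ => hR ρ (Frame.trans ?_ hρ)⟩
          exact hτ.mono (fun _ => id) (fun _ => id)
    exact key N σ h hR

/-- Soundness: a weakest precondition with bounded loops yields an actual run together with its time
bound, so that afterwards only the numbers of rounds have to be controlled. -/
theorem exec_of_wp {O : ℕ → Set ℕ → Prop} {N : ℕ} {P : Prog} {Q : State → Prop} {σ : State}
    (h : wp O N P Q σ) : ∃ t τ, Exec O P σ t τ ∧ t ≤ P.time N ∧ Q τ := by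
  induction P generalizing Q σ with
  | skip => exact ⟨_, _, .skip σ, le_rfl, h⟩
  | assign x e => exact ⟨_, _, .assign x e σ, le_rfl, h⟩
  | store a j e => exact ⟨_, _, .store a j e σ, le_rfl, h⟩
  | query x i a =>
    by_cases ho : O (i.eval σ) {j | σ.arr a j ≠ 0}
    · exact ⟨_, _, .query_yes x i a σ ho, le_rfl, h.1 ho⟩
    · exact ⟨_, _, .query_no x i a σ ho, le_rfl, h.2 ho⟩
  | seq P P' hP hP' =>
    obtain ⟨t, τ, hx, ht, hτ⟩ := hP (Q := wp O N P' Q) h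
    obtain ⟨u, ρ, hy, hu, hρ⟩ := hP' hτ
    exact ⟨_, _, .seq _ _ _ _ _ _ _ hx hy, Nat.add_le_add ht hu, hρ⟩
  | cond e P P' hP hP' =>
    by_cases he : e.eval σ = 0
    · obtain ⟨t, τ, hx, ht, hτ⟩ := hP' (h.2 he)
      exact ⟨_, _, .cond_false _ _ _ _ _ _ he hx, by simp only [Prog.time]; omega, hτ⟩
    · obtain ⟨t, τ, hx, ht, hτ⟩ := hP (h.1 he)
      exact ⟨_, _, .cond_true _ _ _ _ _ _ he hx, by simp only [Prog.time]; omega, hτ⟩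
  | loop e P hP =>
    have key : ∀ m (σ : State), loopWp e (wp O N P) Q m σ →
        ∃ t τ, Exec O (.loop e P) σ t τ ∧ t ≤ m * (e.cost + 1 + P.time N) + (e.cost + 1) ∧
          Q τ := by
      intro m
      induction m with
      | zero => exact fun σ h => ⟨_, _, .loop_false _ _ _ h.1, by omega, h.2⟩
      | succ m ih =>
        rintro σ (h | h)
        · exact ⟨_, _, .loop_false _ _ _ h.1, by omega, h.2⟩
        · obtain ⟨t, τ, hx, ht, hτ⟩ := hP h.2
          obtain ⟨u, ρ, hy, hu, hρ⟩ := ih τ hτ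
          exact ⟨_, _, .loop_true _ _ _ _ _ _ _ h.1 hx hy, by rw [Nat.succ_mul]; omega, hρ⟩
    exact key N σ h

/-- Run `P` with register `i` counting from `0` up to the content of register `b`. -/
def forLoop (i b : ℕ) (P : Prog) : Prog :=
  .seq (.assign i (.const 0))
    (.loop (.lt (.var i) (.var b)) (.seq P (.assign i (.plus (.var i) (.const 1)))))

/-- The invariant rule. The body writes neither the counter nor the bound, so the number of rounds
is fixed at the start; the invariant is stated for the memory in which the counter already has its
new value. -/
theorem wp_forLoop {O : ℕ → Set ℕ → Prop} {N i b : ℕ} {P : Prog} {Q : State → Prop} {σ : State}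
    (Inv : ℕ → State → Prop) (hi : P.writesReg i = false) (hb : P.writesReg b = false)
    (hib : i ≠ b) (hN : σ.reg b ≤ N) (h0 : Inv 0 (σ.setReg i 0))
    (hstep : ∀ j τ, j < σ.reg b → Frame (forLoop i b P) σ τ → τ.reg i = j → Inv j τ →
      wp O N P (fun ρ => Inv (j + 1) (ρ.setReg i (j + 1))) τ)
    (hQ : ∀ τ, Frame (forLoop i b P) σ τ → Inv (σ.reg b) τ → Q τ) :
    wp O N (forLoop i b P) Q σ := by
  have hset : ∀ ρ v, Frame (forLoop i b P) σ ρ → Frame (forLoop i b P) σ (ρ.setReg i v) := by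
    refine fun ρ v hρ => ⟨fun x hx => ?_, hρ.arr⟩
    have : x ≠ i := by
      rintro rfl
      simp [forLoop, Prog.writesReg] at hx
    simp [this, hρ.reg x hx]
  have hbw : (forLoop i b P).writesReg b = false := by
    simp [forLoop, Prog.writesReg, hb, hib.symm]
  have key : ∀ m j (τ : State), j + m = σ.reg b → Frame (forLoop i b P) σ τ → τ.reg i = j →
      Inv j τ → ∀ m', m ≤ m' → loopWp (.lt (.var i) (.var b))
        (wp O N (.seq P (.assign i (.plus (.var i) (.const 1))))) Q m' τ := by
    intro m
    induction m with
    | zero =>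
      intro j τ hj hF hij hI m' _
      have he : (Expr.lt (.var i) (.var b)).eval τ = 0 := by
        simp [Expr.eval, hij, hF.reg b hbw]; omega
      have hQ' : Q τ := hQ τ hF (by rwa [← hj])
      cases m' with
      | zero => exact ⟨he, hQ'⟩
      | succ m' => exact Or.inl ⟨he, hQ'⟩
    | succ m ih =>
      intro j τ hj hF hij hI m' hm'
      obtain ⟨m', rfl⟩ : ∃ m'', m' = m'' + 1 := ⟨m' - 1, by omega⟩
      refine Or.inr ⟨?_, ?_⟩
      · simp [Expr.eval, hij, hF.reg b hbw]; omega
      · change wp O N P (wp O N (.assign i (.plus (.var i) (.const 1))) _) τ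
        refine wp_frame (hstep j τ (by omega) hF hij hI) fun ρ hρ hI' => ?_
        have hri : ρ.reg i = j := (hρ.reg i hi).trans hij
        have hF' : Frame (forLoop i b P) σ ρ := by
          refine hF.trans (hρ.mono ?_ ?_) <;>
            simp +contextual [forLoop, Prog.writesReg, Prog.writesArr]
        simp only [wp, Expr.eval, hri]
        exact ih (j + 1) _ (by omega) (hset _ _ hF') (by simp) hI' m' (by omega)
  exact key _ 0 _ (zero_add _) (hset _ _ (Frame.refl _ _)) (by simp) h0 N hN

end RAM

/-! ### Multiplication and division by repetition. -/

namespace RAM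

/-- `reg d := reg a * reg b`, by repeated addition. -/
def mul (d i a b : ℕ) : Prog :=
  .seq (.assign d (.const 0)) (forLoop i a (.assign d (.plus (.var d) (.var b))))

theorem wp_mul {O : ℕ → Set ℕ → Prop} {N d i a b : ℕ} {Q : State → Prop} {σ : State}
    (hda : d ≠ a) (hdb : d ≠ b) (hdi : d ≠ i) (hia : i ≠ a) (hib : i ≠ b) (hN : σ.reg a ≤ N)
    (hQ : ∀ τ, Frame (mul d i a b) σ τ → τ.reg d = σ.reg a * σ.reg b → Q τ) :
    wp O N (mul d i a b) Q σ := by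
  suffices h : wp O N (mul d i a b) (fun τ => τ.reg d = σ.reg a * σ.reg b) σ from
    wp_frame h fun τ hF hτ => hQ τ hF hτ
  simp only [mul, wp, Expr.eval]
  refine wp_forLoop (fun j τ => τ.reg d = j * σ.reg b) ?_ ?_ hia ?_ ?_ ?_ ?_
  · simpa [Prog.writesReg] using hdi.symm
  · simpa [Prog.writesReg] using hda.symm
  · simpa [hda.symm] using hN
  · simp [hdi]
  · intro j τ _ hF _ hI
    have hb : τ.reg b = σ.reg b := by
      rw [hF.reg b (by simp [forLoop, Prog.writesReg, hib.symm, hdb.symm])]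
      simp [hdb.symm]
    simp [wp, Expr.eval, hdi, hI, hb, Nat.succ_mul]
  · intro τ _ hI
    simpa [hda.symm] using hI

/-- Subtract `reg b` from `reg a` as often as possible, but at most `reg c` times, and count the
subtractions in `reg q`. -/
def divide (q i c a b : ℕ) : Prog :=
  .seq (.assign q (.const 0)) (forLoop i c (.cond (.le (.var b) (.var a))
    (.seq (.assign a (.minus (.var a) (.var b))) (.assign q (.plus (.var q) (.const 1)))) .skip))

/-- The cap `reg c` on the number of subtractions bounds the time even if the quotient is huge; the
quotient is exact whenever it does not exceed the cap. -/
theorem wp_divide {O : ℕ → Set ℕ → Prop} {N q i c a b : ℕ} {Q : State → Prop} {σ : State}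
    (hqi : q ≠ i) (hqc : q ≠ c) (hqa : q ≠ a) (hqb : q ≠ b) (hic : i ≠ c) (hia : i ≠ a)
    (hib : i ≠ b) (hca : c ≠ a) (hab : a ≠ b) (hN : σ.reg c ≤ N)
    (hb : 0 < σ.reg b)
    (hQ : ∀ τ, Frame (divide q i c a b) σ τ → τ.reg q = min (σ.reg a / σ.reg b) (σ.reg c) →
      τ.reg a + τ.reg q * σ.reg b = σ.reg a → Q τ) :
    wp O N (divide q i c a b) Q σ := by
  suffices h : wp O N (divide q i c a b) (fun τ => τ.reg q = min (σ.reg a / σ.reg b) (σ.reg c) ∧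
      τ.reg a + τ.reg q * σ.reg b = σ.reg a) σ from
    wp_frame h fun τ hF hτ => hQ τ hF hτ.1 hτ.2
  simp only [divide, wp, Expr.eval]
  refine wp_forLoop (fun j τ => τ.reg q = min (σ.reg a / σ.reg b) j ∧
      τ.reg a + τ.reg q * σ.reg b = σ.reg a) ?_ ?_ hic ?_ ?_ ?_ ?_
  · simp [Prog.writesReg, hqi.symm, hia]
  · simp [Prog.writesReg, hqc.symm, hca]
  · simpa [hqc.symm] using hN
  · simp [hqi, hia.symm, hqa.symm]
  · rintro j τ _ hF _ ⟨h1, h2⟩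
    have hb' : τ.reg b = σ.reg b := by
      rw [hF.reg b (by simp [forLoop, Prog.writesReg, hib.symm, hqb.symm, hab.symm])]
      simp [hqb.symm]
    have hdm : σ.reg a / σ.reg b * σ.reg b + σ.reg a % σ.reg b = σ.reg a := Nat.div_add_mod' _ _
    have hmod := Nat.mod_lt (σ.reg a) hb
    simp only [wp, Expr.eval, State.setReg_reg, hb']
    simp only [hqi, hia.symm, hqa.symm, hqa, if_true, if_false]
    constructor
    · intro h
      have h3 : σ.reg b ≤ τ.reg a := by omega
      have h4 : τ.reg q + 1 ≤ σ.reg a / σ.reg b := by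
        rw [Nat.le_div_iff_mul_le hb, Nat.succ_mul]; omega
      exact ⟨by omega, by rw [Nat.succ_mul]; omega⟩
    · intro h
      have h3 : τ.reg a < σ.reg b := by omega
      have h4 : σ.reg a / σ.reg b < τ.reg q + 1 := by
        rw [Nat.div_lt_iff_lt_mul hb, Nat.succ_mul]; omega
      exact ⟨by omega, h2⟩
  · intro τ _ hI
    simpa [hqc.symm] using hI

end RAM

/-! ### The instance in memory, and the oracle test for unspanned elements. -/

namespace BMInstance
open RAM

/-- Element number `e` belongs to the ground set of matroid number `i`. -/
def Inc (I : BMInstance) (e i : ℕ) : Prop :=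
  ∃ (e' : Fin I.n) (i' : Fin I.s), e = e' ∧ i = i' ∧ e' ∈ (I.M i').E

/-- The costs as a function on the natural numbers. -/
def costN (I : BMInstance) (j : ℕ) : ℕ := if h : j < I.n then I.cost ⟨j, h⟩ else 0

/-- The profits as a function on the natural numbers. -/
def profitN (I : BMInstance) (j : ℕ) : ℕ := if h : j < I.n then I.profit ⟨j, h⟩ else 0

/-- The part of the memory that holds the instance. -/
structure Loaded (I : BMInstance) (σ : State) : Prop where
  n : σ.reg 0 = I.n
  s : σ.reg 1 = I.s
  k : σ.reg 2 = I.k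
  ℓ : σ.reg 3 = I.ℓ
  budget : σ.reg 4 = I.budget
  cost : σ.arr 0 = I.costN
  profit : σ.arr 1 = I.profitN
  inc : ∀ e i, i < I.s → (σ.arr 2 (e * I.s + i) ≠ 0 ↔ I.Inc e i)

/-- For a concrete program the default proof `rfl` checks by evaluation that none of the input cells
is written. -/
theorem Loaded.frame {I : BMInstance} {P : Prog} {σ τ : State} (h : I.Loaded σ)
    (hF : Frame P σ τ)
    (hP : ((List.range 5).any P.writesReg || (List.range 3).any P.writesArr) = false := by rfl) :
    I.Loaded τ := by
  simp only [Bool.or_eq_false_iff, List.any_eq_false, List.mem_range, Bool.not_eq_true] at hP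
  obtain ⟨hr, ha⟩ := hP
  refine ⟨?_, ?_, ?_, ?_, ?_, ?_, ?_, ?_⟩
  · rw [hF.reg 0 (hr 0 (by omega)), h.n]
  · rw [hF.reg 1 (hr 1 (by omega)), h.s]
  · rw [hF.reg 2 (hr 2 (by omega)), h.k]
  · rw [hF.reg 3 (hr 3 (by omega)), h.ℓ]
  · rw [hF.reg 4 (hr 4 (by omega)), h.budget]
  · rw [hF.arr 0 (ha 0 (by omega)), h.cost]
  · rw [hF.arr 1 (ha 1 (by omega)), h.profit]
  · rw [hF.arr 2 (ha 2 (by omega))]; exact h.inc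

theorem Loaded.setReg {I : BMInstance} {σ : State} (h : I.Loaded σ) {x v : ℕ} (hx : 5 ≤ x) :
    I.Loaded (σ.setReg x v) := by
  have hne : ∀ y, y < 5 → y ≠ x := fun y hy => by omega
  exact ⟨by simp [hne, h.n], by simp [hne, h.s], by simp [hne, h.k], by simp [hne, h.ℓ],
    by simp [hne, h.budget], h.cost, h.profit, h.inc⟩

theorem Loaded.setArr {I : BMInstance} {σ : State} (h : I.Loaded σ) {a j v : ℕ} (ha : 3 ≤ a) :
    I.Loaded (σ.setArr a j v) := by
  have hne : ∀ y, y < 3 → y ≠ a := fun y hy => by omega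
  exact ⟨h.n, h.s, h.k, h.ℓ, h.budget, by simp [hne, h.cost], by simp [hne, h.profit],
    by simpa [hne] using h.inc⟩

theorem loaded_input (I : BMInstance) (ε : ℚ) : I.Loaded (I.input ε) := by
  refine ⟨rfl, rfl, rfl, rfl, rfl, rfl, rfl, fun e i hi => ?_⟩
  simp only [input, Inc, ne_eq, ite_eq_right_iff, one_ne_zero, imp_false, not_not]
  refine exists_congr fun e' => exists_congr fun i' => ?_
  rw [← and_assoc]
  refine and_congr_left fun _ => ⟨fun h => ?_, fun h => by rw [h.1, h.2]⟩
  -- Row and column are recovered from the cell number as quotient and remainder modulo `s`.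
  have h1 := congrArg (· / I.s) h
  have h2 := congrArg (· % I.s) h
  have hs : 0 < I.s := by omega
  simp only [mul_comm _ I.s,
    Nat.mul_add_div hs, Nat.div_eq_of_lt hi, Nat.div_eq_of_lt i'.2, Nat.mul_add_mod,
    Nat.mod_eq_of_lt hi, Nat.mod_eq_of_lt i'.2] at h1 h2
  exact ⟨h1, h2⟩

/-- The pairs in `A` describe one independent set for every matroid: `(x, i)` puts the element `x`
into the set of the `i`-th matroid.  Element `e` is unspanned if it is new and can be added to the
set of every matroid that contains it. -/
def Unspanned (I : BMInstance) (A : Finset (ℕ × ℕ)) (e : ℕ) : Prop :=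
  (∀ i, (e, i) ∉ A) ∧ ∀ i < I.s, I.Inc e i → I.oracle i {v | v = e ∨ (v, i) ∈ A}

/-- Only numbers below `n` matter to the oracle. Hence it does no harm that a branch without
candidates lists the number `n`, nor that the cells of array `6` from `n` on are never cleared. -/
theorem oracle_congr (I : BMInstance) (i : ℕ) {S T : Set ℕ} (h : ∀ v < I.n, v ∈ S ↔ v ∈ T) :
    I.oracle i S ↔ I.oracle i T := by
  have : {e : Fin I.n | (e : ℕ) ∈ S} = {e : Fin I.n | (e : ℕ) ∈ T} := by
    ext e; exact h e e.2
  simp only [oracle, this]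

/-- The first `reg 11` cells of the arrays `4` and `5` list the pairs in `A`. -/
def Lists (σ : State) (A : Finset (ℕ × ℕ)) : Prop :=
  ∀ v i, (v, i) ∈ A ↔ ∃ q < σ.reg 11, σ.arr 5 q = i ∧ σ.arr 4 q = v

theorem Lists.frame {P : Prog} {σ τ : State} {A : Finset (ℕ × ℕ)} (h : Lists σ A)
    (hF : Frame P σ τ) (h11 : P.writesReg 11 = false := by rfl)
    (h4 : P.writesArr 4 = false := by rfl) (h5 : P.writesArr 5 = false := by rfl) :
    Lists τ A := by
  simpa only [Lists, hF.reg 11 h11, hF.arr 4 h4, hF.arr 5 h5] using h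

theorem Lists.setReg {σ : State} {A : Finset (ℕ × ℕ)} (h : Lists σ A) {x v : ℕ} (hx : 11 ≠ x) :
    Lists (σ.setReg x v) A := by
  simpa [Lists, hx] using h

theorem Lists.setArr {σ : State} {A : Finset (ℕ × ℕ)} (h : Lists σ A) {a j v : ℕ} (h4 : 4 ≠ a)
    (h5 : 5 ≠ a) : Lists (σ.setArr a j v) A := by
  simpa [Lists, h4, h5] using h

/-- Clear `reg 20` if the element in `reg 10` is already listed. -/
def testNew : Prog :=
  forLoop 21 11 (.cond (.eq (.get 4 (.var 21)) (.var 10)) (.assign 20 (.const 0)) .skip)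

theorem wp_testNew {O : ℕ → Set ℕ → Prop} {N : ℕ} {Q : State → Prop} {σ : State}
    (hN : σ.reg 11 ≤ N)
    (hQ : ∀ τ, Frame testNew σ τ →
      (τ.reg 20 ≠ 0 ↔ σ.reg 20 ≠ 0 ∧ ∀ q < σ.reg 11, σ.arr 4 q ≠ σ.reg 10) → Q τ) :
    wp O N testNew Q σ := by
  refine wp_forLoop (fun j τ => τ.reg 20 ≠ 0 ↔ σ.reg 20 ≠ 0 ∧ ∀ q < j, σ.arr 4 q ≠ σ.reg 10)
    rfl rfl (by simp) hN (by simp) ?_ hQ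
  intro j τ _ hF hj hI
  have h10 := hF.reg 10 rfl
  have h4 := hF.arr 4 rfl
  simp only [wp, Expr.eval, State.setReg_reg, hj, h10, h4]
  constructor
  · intro h
    have : σ.arr 4 j = σ.reg 10 := by omega
    simp only [Nat.reduceEqDiff, if_true, if_false, ne_eq, not_true,
      false_iff, not_and]
    exact fun _ hq => hq j (by omega) this
  · intro h
    have : σ.arr 4 j ≠ σ.reg 10 := by omega
    simp only [Nat.reduceEqDiff, if_false, hI, Nat.lt_succ_iff_lt_or_eq]
    refine and_congr_right fun _ => ⟨fun hq q hq' => ?_, fun hq q hq' => hq q (Or.inl hq')⟩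
    rcases hq' with hq' | rfl
    exacts [hq q hq', this]

/-- Store the set of the `reg 24`-th matroid, together with the element in `reg 10`, in
array `6`. -/
def loadSet : Prog :=
  .seq (forLoop 25 0 (.store 6 (.var 25) (.const 0)))
    (.seq (forLoop 21 11 (.cond (.eq (.get 5 (.var 21)) (.var 24))
      (.store 6 (.get 4 (.var 21)) (.const 1)) .skip))
      (.store 6 (.var 10) (.const 1)))

theorem wp_loadSet {O : ℕ → Set ℕ → Prop} {N : ℕ} {Q : State → Prop} {σ : State}
    (hn : σ.reg 0 ≤ N) (ht : σ.reg 11 ≤ N)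
    (hQ : ∀ τ, Frame loadSet σ τ → (∀ v < σ.reg 0, τ.arr 6 v ≠ 0 ↔ v = σ.reg 10 ∨
      ∃ q < σ.reg 11, σ.arr 5 q = σ.reg 24 ∧ σ.arr 4 q = v) → Q τ) :
    wp O N loadSet Q σ := by
  suffices h : wp O N loadSet (fun τ => ∀ v < σ.reg 0, τ.arr 6 v ≠ 0 ↔ v = σ.reg 10 ∨
      ∃ q < σ.reg 11, σ.arr 5 q = σ.reg 24 ∧ σ.arr 4 q = v) σ from wp_frame h hQ
  simp only [loadSet, wp, Expr.eval]
  refine wp_forLoop (fun j τ => ∀ v < j, τ.arr 6 v = 0) rfl rfl (by simp) hn (by simp) ?_ ?_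
  · intro j τ _ _ hj hI
    simp only [wp, Expr.eval, hj, State.setReg_arr, State.setArr_arr, if_true,
      Function.update_apply]
    intro v hv
    split_ifs with h
    exacts [rfl, hI v (by omega)]
  · intro τ hF h0
    have e0 := hF.reg 0 rfl
    have e10 := hF.reg 10 rfl
    have e11 := hF.reg 11 rfl
    have e24 := hF.reg 24 rfl
    have e4 := hF.arr 4 rfl
    have e5 := hF.arr 5 rfl
    refine wp_forLoop (fun j τ => ∀ v < σ.reg 0, τ.arr 6 v ≠ 0 ↔
      ∃ q < j, σ.arr 5 q = σ.reg 24 ∧ σ.arr 4 q = v) rfl rfl (by simp) (by omega) ?_ ?_ ?_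
    · intro v hv
      simp [h0 v hv]
    · intro j ρ _ hG hj hI
      have f24 := (hG.reg 24 rfl).trans e24
      have f4 := (hG.arr 4 rfl).trans e4
      have f5 := (hG.arr 5 rfl).trans e5
      simp only [wp, Expr.eval, hj, f24, f4, f5, State.setReg_arr, State.setArr_arr, if_true,
        Function.update_apply]
      constructor
      · intro h v hv
        have h' : σ.arr 5 j = σ.reg 24 := by omega
        split_ifs with h1
        · simp only [ne_eq, one_ne_zero, not_false_eq_true, true_iff]
          exact ⟨j, by omega, h', h1.symm⟩
        · rw [hI v hv]
          refine ⟨fun ⟨q, hq, hq'⟩ => ⟨q, by omega, hq'⟩, fun ⟨q, hq, hq', hv'⟩ =>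
            ⟨q, ?_, hq', hv'⟩⟩
          have : q ≠ j := by rintro rfl; exact h1 hv'.symm
          omega
      · intro h v hv
        have h' : σ.arr 5 j ≠ σ.reg 24 := by omega
        rw [hI v hv]
        refine ⟨fun ⟨q, hq, hq'⟩ => ⟨q, by omega, hq'⟩, fun ⟨q, hq, hq', hv'⟩ =>
          ⟨q, ?_, hq', hv'⟩⟩
        have : q ≠ j := by rintro rfl; exact h' hq'
        omega
    · intro ρ hG hI
      have f10 := (hG.reg 10 rfl).trans e10
      simp only [f10, State.setArr_arr, if_true, Function.update_apply]
      intro v hv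
      split_ifs with h1
      · simp [h1]
      · rw [hI v hv, e11]
        simp [h1]

/-- Test whether the element in `reg 10` is unspanned; the answer goes to `reg 20`. -/
def test : Prog :=
  .seq (.assign 20 (.const 1)) (.seq testNew (.seq (mul 22 23 10 1)
    (forLoop 24 1 (.cond (.get 2 (.plus (.var 22) (.var 24)))
      (.seq loadSet (.seq (.query 26 (.var 24) 6)
        (.cond (.var 26) .skip (.assign 20 (.const 0))))) .skip))))

theorem wp_test {I : BMInstance} {N : ℕ} {Q : State → Prop} {σ : State} {A : Finset (ℕ × ℕ)}
    (hσ : I.Loaded σ) (hA : Lists σ A) (hn : I.n ≤ N) (hs : I.s ≤ N) (ht : σ.reg 11 ≤ N)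
    (he : σ.reg 10 ≤ N)
    (hQ : ∀ τ, Frame test σ τ → (τ.reg 20 ≠ 0 ↔ I.Unspanned A (σ.reg 10)) → Q τ) :
    wp I.oracle N test Q σ := by
  suffices h : wp I.oracle N test (fun τ => τ.reg 20 ≠ 0 ↔ I.Unspanned A (σ.reg 10)) σ from
    wp_frame h hQ
  have hnew : (∀ q < σ.reg 11, σ.arr 4 q ≠ σ.reg 10) ↔ ∀ i, (σ.reg 10, i) ∉ A := by
    simp only [hA _ _]
    refine ⟨fun h i ⟨q, hq, _, hq'⟩ => h q hq hq', fun h q hq hq' => h _ ⟨q, hq, rfl, hq'⟩⟩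
  simp only [test, wp, Expr.eval]
  refine wp_testNew (by simpa using ht) fun τ hF h20 => ?_
  simp only [State.setReg_reg, State.setReg_arr, Nat.reduceEqDiff, if_true,
    if_false, ne_eq, one_ne_zero, not_false_eq_true, true_and] at h20
  simp only [← ne_eq] at h20
  have hτ : I.Loaded τ := (hσ.setReg (x := 20) (by omega)).frame hF
  have e10 : τ.reg 10 = σ.reg 10 := hF.reg 10 rfl
  refine wp_mul (by simp) (by simp) (by simp) (by simp) (by simp) (by omega) fun ρ hG h22 => ?_
  have hρ : I.Loaded ρ := hτ.frame hG
  have f20 : ρ.reg 20 = τ.reg 20 := hG.reg 20 rfl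
  have f10 : ρ.reg 10 = σ.reg 10 := (hG.reg 10 rfl).trans e10
  have f11 : ρ.reg 11 = σ.reg 11 := (hG.reg 11 rfl).trans (hF.reg 11 rfl)
  have hAρ : Lists ρ A := ((hA.setReg (x := 20) (by omega)).frame hF).frame hG
  rw [e10, hτ.s] at h22
  rw [hnew] at h20
  refine wp_forLoop (fun j μ => μ.reg 20 ≠ 0 ↔ (∀ i, (σ.reg 10, i) ∉ A) ∧ ∀ i < j,
    I.Inc (σ.reg 10) i → I.oracle i {v | v = σ.reg 10 ∨ (v, i) ∈ A}) rfl rfl (by simp)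
    (by rw [hρ.s]; exact hs) ?_ ?_ ?_
  · simp [f20, h20]
  · intro j μ hj hH hμj hI
    have hμ : I.Loaded μ := hρ.frame hH
    have hAμ : Lists μ A := hAρ.frame hH
    rw [hρ.s] at hj
    have g22 : μ.reg 22 = σ.reg 10 * I.s := (hH.reg 22 rfl).trans h22
    have g10 : μ.reg 10 = σ.reg 10 := (hH.reg 10 rfl).trans f10
    have g11 : μ.reg 11 = σ.reg 11 := (hH.reg 11 rfl).trans f11
    simp only [wp, Expr.eval, hμj, g22]
    rw [hμ.inc _ _ hj]
    constructor
    · intro hinc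
      refine wp_loadSet (by rw [hμ.n]; exact hn) (by omega) fun ν hK h6 => ?_
      have k24 : ν.reg 24 = j := (hK.reg 24 rfl).trans hμj
      have k20 : ν.reg 20 = μ.reg 20 := hK.reg 20 rfl
      have key : I.oracle j {v | ν.arr 6 v ≠ 0} ↔
          I.oracle j {v | v = σ.reg 10 ∨ (v, j) ∈ A} := by
        refine I.oracle_congr j fun v hv => ?_
        simp only [Set.mem_ofPred_eq]
        rw [h6 v (by rw [hμ.n]; exact hv), hAμ v j, g10, hμj]
      simp only [k24, key, State.setReg_reg]
      refine ⟨fun ho => ⟨fun _ => ?_, fun h => by simp at h⟩,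
        fun ho => ⟨fun h => by simp at h, fun _ => ?_⟩⟩
      · simp only [Nat.reduceEqDiff, if_false, k20, hI,
          Nat.lt_succ_iff_lt_or_eq]
        refine and_congr_right fun _ => ⟨fun h i hi hinc' => ?_, fun h i hi => h i (Or.inl hi)⟩
        rcases hi with hi | rfl
        exacts [h i hi hinc', ho]
      · simp only [Nat.reduceEqDiff, if_false, if_true, ne_eq, not_true,
          false_iff, not_and]
        exact fun _ h => ho (h j (by omega) hinc)
    · intro hinc
      have hinc' : ¬ I.Inc (σ.reg 10) j := fun h => (hμ.inc _ _ hj).2 h hinc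
      simp only [State.setReg_reg, Nat.reduceEqDiff, if_false, hI,
        Nat.lt_succ_iff_lt_or_eq]
      refine and_congr_right fun _ => ⟨fun h i hi hi' => ?_, fun h i hi => h i (Or.inl hi)⟩
      rcases hi with hi | rfl
      exacts [h i hi hi', absurd hi' hinc']
  · intro μ _ hI
    rw [hρ.s] at hI
    exact hI

end BMInstance

/-! ### Following a single branch of the search tree. -/

namespace BMInstance
open RAM

/-- The unspanned elements `e` for which `K` times the profit lies in `[lo, lo + W)`. -/
def Candidate (I : BMInstance) (lo W K : ℕ) (A : Finset (ℕ × ℕ)) (e : ℕ) : Prop :=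
  lo ≤ K * I.profitN e ∧ K * I.profitN e < lo + W ∧ I.Unspanned A e

open Classical in
/-- The first candidate of least cost among the first `j` elements; `n` if there is none. -/
noncomputable def cheapest (I : BMInstance) (lo W K : ℕ) (A : Finset (ℕ × ℕ)) : ℕ → ℕ
  | 0 => I.n
  | j + 1 => if I.Candidate lo W K A j ∧ (I.n ≤ I.cheapest lo W K A j ∨
      I.costN j < I.costN (I.cheapest lo W K A j)) then j else I.cheapest lo W K A j

/-- Put the first candidate of least cost into `reg 15`. -/
def findCheapest : Prog :=
  .seq (.assign 15 (.var 0)) (forLoop 10 0 (.seq (.assign 17 (.get 1 (.var 10)))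
    (.seq (mul 16 27 14 17) (.cond (.le (.var 12) (.var 16))
      (.cond (.lt (.var 16) (.plus (.var 12) (.var 13))) (.seq test (.cond (.var 20)
        (.cond (.plus (.le (.var 0) (.var 15)) (.lt (.get 0 (.var 10)) (.get 0 (.var 15))))
          (.assign 15 (.var 10)) .skip) .skip)) .skip) .skip))))

theorem wp_findCheapest {I : BMInstance} {N : ℕ} {Q : State → Prop} {σ : State}
    {A : Finset (ℕ × ℕ)} (hσ : I.Loaded σ) (hA : Lists σ A) (hn : I.n ≤ N) (hs : I.s ≤ N)
    (ht : σ.reg 11 ≤ N) (hK : σ.reg 14 ≤ N)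
    (hQ : ∀ τ, Frame findCheapest σ τ →
      τ.reg 15 = I.cheapest (σ.reg 12) (σ.reg 13) (σ.reg 14) A I.n → Q τ) :
    wp I.oracle N findCheapest Q σ := by
  suffices h : wp I.oracle N findCheapest (fun τ =>
      τ.reg 15 = I.cheapest (σ.reg 12) (σ.reg 13) (σ.reg 14) A I.n) σ from wp_frame h hQ
  simp only [findCheapest, wp, Expr.eval]
  refine wp_forLoop (fun j τ => τ.reg 15 = I.cheapest (σ.reg 12) (σ.reg 13) (σ.reg 14) A j)
    rfl rfl (by simp) (by simpa [hσ.n] using hn) ?_ ?_ ?_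
  · simp [cheapest, hσ.n]
  · intro j τ hj hF hτj hI
    have hj' : j < I.n := by simpa [hσ.n] using hj
    have hτ : I.Loaded τ := (hσ.setReg (x := 15) (by omega)).frame hF
    have hAτ : Lists τ A := (hA.setReg (x := 15) (by omega)).frame hF
    have e11 : τ.reg 11 = σ.reg 11 := hF.reg 11 rfl
    have e12 : τ.reg 12 = σ.reg 12 := hF.reg 12 rfl
    have e13 : τ.reg 13 = σ.reg 13 := hF.reg 13 rfl
    have e14 : τ.reg 14 = σ.reg 14 := hF.reg 14 rfl
    simp only [wp, Expr.eval, hτj]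
    -- The number of rounds is the factor `K` in `reg 14`, not the profit, which may be exponential
    -- in the encoding size.
    refine wp_mul (by simp) (by simp) (by simp) (by simp) (by simp)
      (by simpa [e14] using hK) fun ρ hG h16 => ?_
    have hρ : I.Loaded ρ := (hτ.setReg (x := 17) (by omega)).frame hG
    have hAρ : Lists ρ A := (hAτ.setReg (x := 17) (by omega)).frame hG
    have f10 : ρ.reg 10 = j := (hG.reg 10 rfl).trans hτj
    have f11 : ρ.reg 11 = σ.reg 11 := (hG.reg 11 rfl).trans e11
    have f12 : ρ.reg 12 = σ.reg 12 := (hG.reg 12 rfl).trans e12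
    have f13 : ρ.reg 13 = σ.reg 13 := (hG.reg 13 rfl).trans e13
    have f15 : ρ.reg 15 = τ.reg 15 := hG.reg 15 rfl
    rw [hI] at f15
    simp only [State.setReg_reg, Nat.reduceEqDiff, if_false, if_true, e14, hτ.profit] at h16
    simp only [h16, f12, f13]
    constructor
    · intro h1
      constructor
      · intro h2
        refine wp_test hρ hAρ hn hs (by omega) (by omega) fun μ hH h20 => ?_
        have hμ : I.Loaded μ := hρ.frame hH
        have g10 : μ.reg 10 = j := (hH.reg 10 rfl).trans f10
        have g15 := (hH.reg 15 rfl).trans f15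
        rw [f10] at h20
        simp only [hμ.n, hμ.cost, g10, g15, State.setReg_reg, Nat.reduceEqDiff, if_false,
          if_true, cheapest]
        constructor
        · intro h3
          constructor
          · intro h4
            -- The program adds two tests; the sum is nonzero exactly if one of them succeeds, which
            -- is the disjunction in `cheapest`.
            rw [if_pos ⟨⟨by omega, by omega, h20.1 h3⟩, by omega⟩]
          · intro h4
            rw [if_neg (by rintro ⟨_, h5 | h5⟩ <;> omega)]
        · intro h3
          rw [if_neg (by rintro ⟨⟨_, _, h5⟩, _⟩; exact h20.2 h5 h3)]
      · intro h2
        simp only [f15, State.setReg_reg, Nat.reduceEqDiff, if_false, cheapest]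
        rw [if_neg (by rintro ⟨⟨_, h5, _⟩, _⟩; omega)]
    · intro h1
      simp only [f15, State.setReg_reg, Nat.reduceEqDiff, if_false, cheapest]
      rw [if_neg (by rintro ⟨⟨h5, _, _⟩, _⟩; omega)]
  · intro τ _ hI
    simpa [hσ.n] using hI

open Classical in
/-- The number `i < j` with `p i` that has exactly `d` predecessors with this property, and `s` if
there is none. -/
noncomputable def select (p : ℕ → Prop) (d s : ℕ) : ℕ → ℕ
  | 0 => s
  | j + 1 => if p j ∧ Nat.count p j = d then j else select p d s j

/-- One step of a branch: choose the cheapest candidate `x`, and add it to the set of the matroid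
that the last digit of `w` to the base `ℓ` selects among those containing `x`. -/
noncomputable def step (I : BMInstance) (lo W K : ℕ) (p : Finset (ℕ × ℕ) × ℕ) :
    Finset (ℕ × ℕ) × ℕ :=
  (insert (I.cheapest lo W K p.1 I.n,
    select (I.Inc (I.cheapest lo W K p.1 I.n)) (p.2 % I.ℓ) I.s I.s) p.1, p.2 / I.ℓ)

/-- The element chosen in the `t`-th step of the branch with the number `w`. -/
noncomputable def chosen (I : BMInstance) (lo W K w t : ℕ) : ℕ :=
  I.cheapest lo W K ((I.step lo W K)^[t] (∅, w)).1 I.n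

/-- Put the matroid containing the element in `reg 15` that is selected by `reg 30` into
`reg 33`. -/
def selectMatroid : Prog :=
  .seq (mul 31 32 15 1) (.seq (.assign 33 (.var 1)) (forLoop 29 1
    (.cond (.get 2 (.plus (.var 31) (.var 29))) (.seq
      (.cond (.eq (.var 30) (.const 1)) (.assign 33 (.var 29)) .skip)
      (.assign 30 (.minus (.var 30) (.const 1)))) .skip)))

open Classical in
theorem wp_selectMatroid {I : BMInstance} {N d : ℕ} {Q : State → Prop} {σ : State}
    (hσ : I.Loaded σ) (hs : I.s ≤ N) (h15 : σ.reg 15 ≤ N) (h30 : σ.reg 30 = d + 1)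
    (hQ : ∀ τ, Frame selectMatroid σ τ → τ.reg 33 = select (I.Inc (σ.reg 15)) d I.s I.s → Q τ) :
    wp I.oracle N selectMatroid Q σ := by
  suffices h : wp I.oracle N selectMatroid (fun τ =>
      τ.reg 33 = select (I.Inc (σ.reg 15)) d I.s I.s) σ from wp_frame h hQ
  simp only [selectMatroid, wp, Expr.eval]
  refine wp_mul (by simp) (by simp) (by simp) (by simp) (by simp) h15 fun τ hF h31 => ?_
  have hτ : I.Loaded τ := hσ.frame hF
  have e30 : τ.reg 30 = d + 1 := (hF.reg 30 rfl).trans h30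
  have e1 : (τ.setReg 33 (τ.reg 1)).reg 1 = I.s := by simp [hτ.s]
  rw [hσ.s] at h31
  -- `reg 30` counts down from `d + 1`, once for each matroid containing the element. It is `1`
  -- exactly when the one with `d` predecessors is due, and the offset distinguishes this from the
  -- value `0`, at which truncated subtraction stays forever.
  refine wp_forLoop (fun j τ => τ.reg 33 = select (I.Inc (σ.reg 15)) d I.s j ∧
    τ.reg 30 = d + 1 - Nat.count (I.Inc (σ.reg 15)) j) rfl rfl (by simp) (by rw [e1]; exact hs)
    ?_ ?_ ?_
  · simp [select, hτ.s, e30]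
  · rintro j ρ hj hG hρj ⟨hI, hI'⟩
    rw [e1] at hj
    have hρ : I.Loaded ρ := (hτ.setReg (x := 33) (by omega)).frame hG
    have f31 : ρ.reg 31 = σ.reg 15 * I.s := (hG.reg 31 rfl).trans h31
    simp only [wp, Expr.eval, hρj, f31, hI', State.setReg_reg, Nat.reduceEqDiff, if_false,
      if_true, select]
    rw [hρ.inc _ _ hj]
    constructor
    · intro hinc
      have hc : Nat.count (I.Inc (σ.reg 15)) (j + 1) = Nat.count (I.Inc (σ.reg 15)) j + 1 := by
        simp [Nat.count_succ, hinc]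
      constructor
      · intro h
        exact ⟨by rw [if_pos ⟨hinc, by omega⟩], by omega⟩
      · intro h
        exact ⟨by rw [if_neg (by rintro ⟨_, h'⟩; omega), hI], by omega⟩
    · intro h
      have hinc : ¬ I.Inc (σ.reg 15) j := fun h' => (hρ.inc _ _ hj).2 h' h
      have hc : Nat.count (I.Inc (σ.reg 15)) (j + 1) = Nat.count (I.Inc (σ.reg 15)) j := by
        simp [Nat.count_succ, hinc]
      exact ⟨by rw [if_neg (fun h' => hinc h'.1), hI], by omega⟩
  · rintro ρ _ ⟨hI, _⟩
    rwa [e1] at hI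

theorem cheapest_le (I : BMInstance) (lo W K : ℕ) (A : Finset (ℕ × ℕ)) {j : ℕ} (hj : j ≤ I.n) :
    I.cheapest lo W K A j ≤ I.n := by
  induction j with
  | zero => exact le_rfl
  | succ j ih =>
    rw [cheapest]
    split_ifs
    exacts [by omega, ih (by omega)]

/-- The remaining digits never exceed the branch number, which is at most `n` in the algorithm; so
the division by `ℓ` with cap `n` is exact. -/
theorem iterate_step_snd_le (I : BMInstance) (lo W K w t : ℕ) :
    ((I.step lo W K)^[t] (∅, w)).2 ≤ w := by
  induction t with
  | zero => exact le_rfl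
  | succ t ih =>
    rw [Function.iterate_succ_apply']
    exact (Nat.div_le_self _ _).trans ih

/-- Follow the branch with the number `reg 18` for `reg 34` steps and output the chosen
elements. -/
def followBranch : Prog :=
  .seq (.assign 19 (.var 18)) (forLoop 11 34 (.seq findCheapest
    (.seq (.store 3 (.var 15) (.const 1)) (.seq (divide 28 29 0 19 3)
      (.seq (.assign 30 (.plus (.var 19) (.const 1))) (.seq (.assign 19 (.var 28))
        (.seq selectMatroid (.seq (.store 4 (.var 11) (.var 15))
          (.store 5 (.var 11) (.var 33))))))))))

theorem wp_followBranch {I : BMInstance} {N : ℕ} {Q : State → Prop} {σ : State}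
    (hσ : I.Loaded σ) (hn : I.n ≤ N) (hs : I.s ≤ N) (ht : σ.reg 34 ≤ N) (hK : σ.reg 14 ≤ N)
    (hw : σ.reg 18 ≤ I.n)
    (hQ : ∀ τ, Frame followBranch σ τ → (∀ v, τ.arr 3 v ≠ 0 ↔ σ.arr 3 v ≠ 0 ∨
      ∃ t < σ.reg 34, v = I.chosen (σ.reg 12) (σ.reg 13) (σ.reg 14) (σ.reg 18) t) → Q τ) :
    wp I.oracle N followBranch Q σ := by
  suffices h : wp I.oracle N followBranch (fun τ => ∀ v, τ.arr 3 v ≠ 0 ↔ σ.arr 3 v ≠ 0 ∨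
      ∃ t < σ.reg 34, v = I.chosen (σ.reg 12) (σ.reg 13) (σ.reg 14) (σ.reg 18) t) σ from
    wp_frame h hQ
  simp only [followBranch, wp, Expr.eval]
  -- Register `11` is both the step counter and the length of the list of pairs, so that advancing
  -- the counter appends the pair just stored.
  refine wp_forLoop (fun j τ => (∀ v, τ.arr 3 v ≠ 0 ↔ σ.arr 3 v ≠ 0 ∨
      ∃ t < j, v = I.chosen (σ.reg 12) (σ.reg 13) (σ.reg 14) (σ.reg 18) t) ∧
      (τ.reg 11 = j → Lists τ
        ((I.step (σ.reg 12) (σ.reg 13) (σ.reg 14))^[j] (∅, σ.reg 18)).1) ∧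
      τ.reg 19 = ((I.step (σ.reg 12) (σ.reg 13) (σ.reg 14))^[j] (∅, σ.reg 18)).2)
    rfl rfl (by simp) (by simpa using ht) ?_ ?_ ?_
  · simp [Lists]
  · rintro j τ hj hF hτj ⟨h3, hA, h19⟩
    replace hA := hA hτj
    have hj' : j < σ.reg 34 := by simpa using hj
    have hτ : I.Loaded τ := (hσ.setReg (x := 19) (by omega)).frame hF
    have e12 : τ.reg 12 = σ.reg 12 := hF.reg 12 rfl
    have e13 : τ.reg 13 = σ.reg 13 := hF.reg 13 rfl
    have e14 : τ.reg 14 = σ.reg 14 := hF.reg 14 rfl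
    have hwle := I.iterate_step_snd_le (σ.reg 12) (σ.reg 13) (σ.reg 14) (σ.reg 18) j
    simp only [Function.iterate_succ_apply']
    set p := (I.step (σ.reg 12) (σ.reg 13) (σ.reg 14))^[j] (∅, σ.reg 18) with hp
    simp only [wp, Expr.eval]
    refine wp_findCheapest hτ hA hn hs (by omega) (by omega) fun ρ hG h15 => ?_
    have hρ : I.Loaded ρ := hτ.frame hG
    have hAρ : Lists ρ p.1 := hA.frame hG
    have f11 : ρ.reg 11 = j := (hG.reg 11 rfl).trans hτj
    have f19 : ρ.reg 19 = p.2 := (hG.reg 19 rfl).trans h19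
    have f3 : ρ.arr 3 = τ.arr 3 := hG.arr 3 rfl
    rw [e12, e13, e14] at h15
    set x := I.cheapest (σ.reg 12) (σ.reg 13) (σ.reg 14) p.1 I.n with hx
    have hxn : x ≤ I.n := I.cheapest_le _ _ _ _ le_rfl
    have hρ' : I.Loaded (ρ.setArr 3 (ρ.reg 15) 1) := hρ.setArr (by omega)
    refine wp_divide (by simp) (by simp) (by simp) (by simp) (by simp) (by simp) (by simp)
      (by simp) (by simp) (by rw [hρ'.n]; exact hn) (by rw [hρ'.ℓ]; exact I.ℓ_pos)
      fun μ hH h28 hr => ?_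
    have hμ : I.Loaded μ := hρ'.frame hH
    have g15 : μ.reg 15 = x := (hH.reg 15 rfl).trans h15
    rw [hρ'.n, hρ'.ℓ] at h28
    rw [hρ'.ℓ] at hr
    simp only [State.setArr_reg, f19] at h28 hr
    have hdiv : p.2 / I.ℓ ≤ p.2 := Nat.div_le_self _ _
    -- The cap is inactive, since `p.2 / ℓ ≤ p.2 ≤ w ≤ n`.
    rw [min_eq_left (by omega)] at h28
    rw [h28] at hr
    have hmod : μ.reg 19 = p.2 % I.ℓ := by
      have := Nat.mod_add_div' p.2 I.ℓ
      omega
    refine wp_selectMatroid (d := p.2 % I.ℓ) ((hμ.setReg (by omega)).setReg (by omega)) hs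
      (by simp [g15]; omega) (by simp [hmod]) fun ν hJ h33 => ?_
    have hAν : Lists ν p.1 :=
      ((((hAρ.setArr (by omega) (by omega)).frame hH).setReg (by omega)).setReg
        (by omega)).frame hJ
    have k11 : ν.reg 11 = j := ((hJ.reg 11 rfl).trans (hH.reg 11 rfl)).trans f11
    have k15 : ν.reg 15 = x := (hJ.reg 15 rfl).trans g15
    have k19 : ν.reg 19 = p.2 / I.ℓ := (hJ.reg 19 rfl).trans h28
    have k3 : ν.arr 3 = Function.update (τ.arr 3) x 1 := by
      rw [hJ.arr 3 rfl, State.setReg_arr, State.setReg_arr, hH.arr 3 rfl]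
      simp [f3, h15]
    simp only [State.setReg_reg, Nat.reduceEqDiff, if_false, g15] at h33
    refine ⟨fun v => ?_, fun _ => ?_, ?_⟩
    · simp only [State.setReg_arr, State.setArr_arr, Nat.reduceEqDiff, if_false, k3,
        Function.update_apply, Nat.lt_succ_iff_lt_or_eq]
      have hc : I.chosen (σ.reg 12) (σ.reg 13) (σ.reg 14) (σ.reg 18) j = x := rfl
      split_ifs with h
      · simp only [ne_eq, one_ne_zero, not_false_eq_true, true_iff]
        exact Or.inr ⟨j, Or.inr rfl, h.trans hc.symm⟩
      · rw [h3 v]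
        refine or_congr_right ⟨fun ⟨t, h1, h2⟩ => ⟨t, Or.inl h1, h2⟩, fun ⟨t, h1, h2⟩ => ?_⟩
        rcases h1 with h1 | rfl
        exacts [⟨t, h1, h2⟩, absurd (h2.trans hc) h]
    · intro v i
      have hstep : (I.step (σ.reg 12) (σ.reg 13) (σ.reg 14) p).1 =
        insert (x, select (I.Inc x) (p.2 % I.ℓ) I.s I.s) p.1 := rfl
      rw [hstep, Finset.mem_insert, hAν v i]
      simp only [State.setReg_reg, State.setReg_arr, State.setArr_arr, State.setArr_reg,
        Nat.reduceEqDiff, if_false, if_true, k11, k15, h33, Function.update_apply,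
        Nat.lt_succ_iff_lt_or_eq, Prod.mk.injEq]
      constructor
      · rintro (⟨rfl, rfl⟩ | ⟨q, hq, h1, h2⟩)
        · exact ⟨j, Or.inr rfl, by simp⟩
        · exact ⟨q, Or.inl hq, by simp [hq.ne, h1, h2]⟩
      · rintro ⟨q, hq | rfl, h1, h2⟩
        · rw [if_neg hq.ne] at h1 h2
          exact Or.inr ⟨q, hq, h1, h2⟩
        · rw [if_pos rfl] at h1 h2
          exact Or.inl ⟨h2.symm, h1.symm⟩
    · simpa [step] using k19
  · rintro τ _ ⟨h3, _⟩
    simpa using h3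

end BMInstance

/-! ### The whole algorithm: all branches, all profit classes, and the early exits. -/

namespace BMInstance
open RAM

/-- Follow the branches with the numbers below `reg 35`. -/
def followBranches : Prog := forLoop 18 35 followBranch

theorem wp_followBranches {I : BMInstance} {N : ℕ} {Q : State → Prop} {σ : State}
    (hσ : I.Loaded σ) (hn : I.n ≤ N) (hs : I.s ≤ N) (ht : σ.reg 34 ≤ N) (hK : σ.reg 14 ≤ N)
    (hL : σ.reg 35 ≤ I.n)
    (hQ : ∀ τ, Frame followBranches σ τ → (∀ v, τ.arr 3 v ≠ 0 ↔ σ.arr 3 v ≠ 0 ∨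
      ∃ w < σ.reg 35, ∃ t < σ.reg 34,
        v = I.chosen (σ.reg 12) (σ.reg 13) (σ.reg 14) w t) → Q τ) :
    wp I.oracle N followBranches Q σ := by
  refine wp_forLoop (fun j τ => ∀ v, τ.arr 3 v ≠ 0 ↔ σ.arr 3 v ≠ 0 ∨
    ∃ w < j, ∃ t < σ.reg 34, v = I.chosen (σ.reg 12) (σ.reg 13) (σ.reg 14) w t)
    rfl rfl (by simp) (by omega) (by simp) ?_ hQ
  intro j τ hj hF hτj hI
  have e34 : τ.reg 34 = σ.reg 34 := hF.reg 34 rfl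
  have e12 : τ.reg 12 = σ.reg 12 := hF.reg 12 rfl
  have e13 : τ.reg 13 = σ.reg 13 := hF.reg 13 rfl
  have e14 : τ.reg 14 = σ.reg 14 := hF.reg 14 rfl
  refine wp_followBranch (hσ.frame hF) hn hs (by omega) (by omega) (by omega) fun ρ _ h3 => ?_
  rw [e34, e12, e13, e14, hτj] at h3
  intro v
  rw [State.setReg_arr, h3 v, hI v, or_assoc]
  refine or_congr_right ⟨?_, ?_⟩
  · rintro (⟨w, hw, h⟩ | h)
    exacts [⟨w, by omega, h⟩, ⟨j, by omega, h⟩]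
  · rintro ⟨w, hw, h⟩
    rcases Nat.lt_succ_iff_lt_or_eq.1 hw with hw | rfl
    exacts [Or.inl ⟨w, hw, h⟩, Or.inr h]

/-- Follow the branches of the first `reg 37` profit classes. -/
def followClasses : Prog :=
  .seq (.assign 12 (.const 0)) (forLoop 36 37 (.seq followBranches
    (.assign 12 (.plus (.var 12) (.var 13)))))

theorem wp_followClasses {I : BMInstance} {N : ℕ} {Q : State → Prop} {σ : State}
    (hσ : I.Loaded σ) (hn : I.n ≤ N) (hs : I.s ≤ N) (ht : σ.reg 34 ≤ N) (hK : σ.reg 14 ≤ N)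
    (hL : σ.reg 35 ≤ I.n) (h37 : σ.reg 37 ≤ N)
    (hQ : ∀ τ, Frame followClasses σ τ → (∀ v, τ.arr 3 v ≠ 0 ↔ σ.arr 3 v ≠ 0 ∨
      ∃ j < σ.reg 37, ∃ w < σ.reg 35, ∃ t < σ.reg 34,
        v = I.chosen (j * σ.reg 13) (σ.reg 13) (σ.reg 14) w t) → Q τ) :
    wp I.oracle N followClasses Q σ := by
  suffices h : wp I.oracle N followClasses (fun τ => ∀ v, τ.arr 3 v ≠ 0 ↔ σ.arr 3 v ≠ 0 ∨
      ∃ j < σ.reg 37, ∃ w < σ.reg 35, ∃ t < σ.reg 34,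
        v = I.chosen (j * σ.reg 13) (σ.reg 13) (σ.reg 14) w t) σ from wp_frame h hQ
  simp only [followClasses, wp, Expr.eval]
  refine wp_forLoop (fun i τ => (∀ v, τ.arr 3 v ≠ 0 ↔ σ.arr 3 v ≠ 0 ∨
    ∃ j < i, ∃ w < σ.reg 35, ∃ t < σ.reg 34,
      v = I.chosen (j * σ.reg 13) (σ.reg 13) (σ.reg 14) w t) ∧ τ.reg 12 = i * σ.reg 13)
    rfl rfl (by simp) (by simpa using h37) (by simp) ?_ ?_
  · rintro i τ hi hF hτi ⟨hI, h12⟩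
    have hτ : I.Loaded τ := (hσ.setReg (by omega)).frame hF
    have e34 : τ.reg 34 = σ.reg 34 := hF.reg 34 rfl
    have e35 : τ.reg 35 = σ.reg 35 := hF.reg 35 rfl
    have e13 : τ.reg 13 = σ.reg 13 := hF.reg 13 rfl
    have e14 : τ.reg 14 = σ.reg 14 := hF.reg 14 rfl
    simp only [wp, Expr.eval]
    refine wp_followBranches hτ hn hs (by omega) (by omega) (by omega) fun ρ hG h3 => ?_
    have f13 : ρ.reg 13 = σ.reg 13 := (hG.reg 13 rfl).trans e13
    have f12 : ρ.reg 12 = i * σ.reg 13 := (hG.reg 12 rfl).trans h12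
    rw [e34, h12, e13, e14, e35] at h3
    refine ⟨fun v => ?_, by simp [f12, f13, Nat.succ_mul]⟩
    rw [State.setReg_arr, State.setReg_arr, h3 v, hI v, or_assoc]
    refine or_congr_right ⟨?_, ?_⟩
    · rintro (⟨w, hw, h⟩ | h)
      exacts [⟨w, by omega, h⟩, ⟨i, by omega, h⟩]
    · rintro ⟨w, hw, h⟩
      rcases Nat.lt_succ_iff_lt_or_eq.1 hw with hw | rfl
      exacts [Or.inl ⟨w, hw, h⟩, Or.inr h]
  · rintro τ _ ⟨h, _⟩
    simpa using h

/-- The set consisting of `e` alone is a solution. -/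
def Single (I : BMInstance) (e : ℕ) : Prop := I.Unspanned ∅ e ∧ I.costN e ≤ I.budget

/-- `W` is the largest profit of a solution with one element, and `0` if there is none. -/
def IsMaxSingle (I : BMInstance) (W : ℕ) : Prop :=
  (∀ e < I.n, I.Single e → I.profitN e ≤ W) ∧
    (W = 0 ∨ ∃ e < I.n, I.Single e ∧ I.profitN e = W)

/-- Put the largest profit of a solution with one element into `reg 13`. -/
def maxSingle : Prog :=
  .seq (.assign 13 (.const 0)) (.seq (.assign 11 (.const 0)) (forLoop 10 0 (.seq test
    (.cond (.var 20) (.cond (.le (.get 0 (.var 10)) (.var 4))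
      (.cond (.lt (.var 13) (.get 1 (.var 10))) (.assign 13 (.get 1 (.var 10))) .skip)
        .skip) .skip))))

theorem wp_maxSingle {I : BMInstance} {N : ℕ} {Q : State → Prop} {σ : State}
    (hσ : I.Loaded σ) (hn : I.n ≤ N) (hs : I.s ≤ N)
    (hQ : ∀ τ, Frame maxSingle σ τ → I.IsMaxSingle (τ.reg 13) → Q τ) :
    wp I.oracle N maxSingle Q σ := by
  suffices h : wp I.oracle N maxSingle (fun τ => I.IsMaxSingle (τ.reg 13)) σ from wp_frame h hQ
  simp only [maxSingle, wp, Expr.eval]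
  refine wp_forLoop (fun j τ => (∀ e < j, I.Single e → I.profitN e ≤ τ.reg 13) ∧
    (τ.reg 13 = 0 ∨ ∃ e < I.n, I.Single e ∧ I.profitN e = τ.reg 13)) rfl rfl (by simp)
    (by simpa [hσ.n] using hn) (by simp) ?_ ?_
  · rintro j τ hj hF hτj ⟨h1, h2⟩
    have hj' : j < I.n := by simpa [hσ.n] using hj
    have hτ : I.Loaded τ := ((hσ.setReg (by omega)).setReg (by omega)).frame hF
    have e11 : τ.reg 11 = 0 := hF.reg 11 rfl
    simp only [wp, Expr.eval]
    refine wp_test (A := ∅) hτ (by simp [Lists, e11]) hn hs (by omega) (by omega)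
      fun ρ hG h20 => ?_
    have hρ : I.Loaded ρ := hτ.frame hG
    have f10 : ρ.reg 10 = j := (hG.reg 10 rfl).trans hτj
    have f13 : ρ.reg 13 = τ.reg 13 := hG.reg 13 rfl
    rw [hτj] at h20
    have hkeep : ¬ (I.Single j ∧ τ.reg 13 < I.profitN j) →
        (∀ e < j + 1, I.Single e → I.profitN e ≤ τ.reg 13) := by
      intro h e he hse
      rcases Nat.lt_succ_iff_lt_or_eq.1 he with he | rfl
      · exact h1 e he hse
      · exact not_lt.1 fun h' => h ⟨hse, h'⟩
    simp only [f10, f13, hρ.cost, hρ.profit, hρ.budget, State.setReg_reg, Nat.reduceEqDiff,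
      if_false, if_true]
    refine ⟨fun h3 => ⟨fun h4 => ⟨fun h5 => ?_, fun h5 => ?_⟩, fun h4 => ?_⟩, fun h3 => ?_⟩
    · refine ⟨fun e he hse => ?_, Or.inr ⟨j, hj', ⟨h20.1 h3, by omega⟩, rfl⟩⟩
      rcases Nat.lt_succ_iff_lt_or_eq.1 he with he | rfl
      · exact (h1 e he hse).trans (by omega)
      · exact le_rfl
    · exact ⟨hkeep fun h => by omega, h2⟩
    · exact ⟨hkeep fun h => by have := h.1.2; omega, h2⟩
    · exact ⟨hkeep fun h => h20.2 h.1.1 h3, h2⟩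
  · rintro τ _ h
    simpa [hσ.n, IsMaxSingle] using h

/-- Output all elements. -/
def outputAll : Prog := forLoop 10 0 (.store 3 (.var 10) (.const 1))

theorem wp_outputAll {I : BMInstance} {N : ℕ} {Q : State → Prop} {σ : State}
    (hσ : I.Loaded σ) (hn : I.n ≤ N) (hQ : ∀ τ, (∀ v < I.n, τ.arr 3 v ≠ 0) → Q τ) :
    wp I.oracle N outputAll Q σ := by
  refine wp_forLoop (fun j τ => ∀ v < j, τ.arr 3 v ≠ 0) rfl rfl (by simp)
    (by simpa [hσ.n] using hn) (by simp) ?_ ?_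
  · intro j τ _ _ hj hI
    simp only [wp, Expr.eval, hj, State.setReg_arr, State.setArr_arr, if_true,
      Function.update_apply]
    intro v hv
    split_ifs with h
    exacts [one_ne_zero, hI v (by omega)]
  · intro τ _ hI
    exact hQ τ (by simpa [hσ.n] using hI)

/-- Put the power of `reg 3` with the exponent `reg 44` into `reg 35`; stop as soon as it is not
less than `reg 0`. -/
def cappedPow : Prog :=
  .seq (.assign 35 (.const 1)) (forLoop 42 44 (.cond (.lt (.var 35) (.var 0))
    (.seq (mul 45 46 35 3) (.assign 35 (.var 45))) .skip))

/-- Multiplication happens only while the current value, which is the number of rounds, is below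
`n`. Once the value reaches `n`, the true power is at least `n` too and stays so because `ℓ ≥ 1`; in
that case the exact value is not needed. -/
theorem wp_cappedPow {I : BMInstance} {N : ℕ} {Q : State → Prop} {σ : State}
    (hσ : I.Loaded σ) (hn : I.n ≤ N) (hD : σ.reg 44 ≤ N)
    (hQ : ∀ τ, Frame cappedPow σ τ → (τ.reg 35 = I.ℓ ^ σ.reg 44 ∨
      I.n ≤ τ.reg 35 ∧ I.n ≤ I.ℓ ^ σ.reg 44) → Q τ) :
    wp I.oracle N cappedPow Q σ := by
  suffices h : wp I.oracle N cappedPow (fun τ => τ.reg 35 = I.ℓ ^ σ.reg 44 ∨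
      I.n ≤ τ.reg 35 ∧ I.n ≤ I.ℓ ^ σ.reg 44) σ from wp_frame h hQ
  simp only [cappedPow, wp, Expr.eval]
  refine wp_forLoop (fun j τ => τ.reg 35 = I.ℓ ^ j ∨ I.n ≤ τ.reg 35 ∧ I.n ≤ I.ℓ ^ j)
    rfl rfl (by simp) (by simpa using hD) (by simp) ?_ ?_
  · intro j τ hj hF hτj hI
    have hτ : I.Loaded τ := (hσ.setReg (by omega)).frame hF
    simp only [wp, Expr.eval]
    rw [hτ.n]
    constructor
    · intro h
      refine wp_mul (by simp) (by simp) (by simp) (by simp) (by simp) (by omega)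
        fun ρ hG h45 => ?_
      rw [hτ.ℓ] at h45
      left
      rcases hI with hI | hI
      · simp [h45, hI, pow_succ]
      · omega
    · intro h
      right
      simp only [State.setReg_reg, Nat.reduceEqDiff, if_false]
      have hpow : I.ℓ ^ j ≤ I.ℓ ^ (j + 1) := Nat.pow_le_pow_right I.ℓ_pos (by omega)
      omega
  · intro τ _ hI
    simpa using hI

/-- The algorithm: if one of `1 / ε`, `k`, `(k - 1) ℓ` and `ℓ ^ ((k - 1) ℓ)` is at least `n`,
then it outputs all elements; otherwise, it follows all branches of all profit classes. -/
def algorithm : Prog :=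
  .seq (.assign 40 (.var 6)) (.seq (divide 41 42 0 40 5)
    (.cond (.le (.var 0) (.var 41)) outputAll
    (.cond (.le (.var 0) (.var 2)) outputAll
    (.seq (.assign 43 (.minus (.var 2) (.const 1))) (.seq (mul 44 42 43 3)
    (.cond (.le (.var 0) (.var 44)) outputAll
    (.seq cappedPow
    (.cond (.le (.var 0) (.var 35)) outputAll
    (.seq (mul 14 42 2 41) (.seq maxSingle
    (.seq (.assign 37 (.plus (.var 14) (.const 1)))
    (.seq (.assign 34 (.plus (.var 44) (.const 1))) followClasses))))))))))))

theorem wp_algorithm (I : BMInstance) {ε : ℚ} (hε : 0 < ε) {N : ℕ} (hn : I.n ≤ N)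
    (hnn : I.n * I.n ≤ N) (hs : I.s ≤ N) :
    wp I.oracle N algorithm (fun τ =>
      ((I.n ≤ ε.den / ε.num.toNat ∨ I.n ≤ I.k ∨ I.n ≤ (I.k - 1) * I.ℓ ∨
        I.n ≤ I.ℓ ^ ((I.k - 1) * I.ℓ)) ∧ ∀ v < I.n, τ.arr 3 v ≠ 0) ∨
      ∃ W, I.IsMaxSingle W ∧ ∀ v, τ.arr 3 v ≠ 0 ↔
        ∃ j < I.k * (ε.den / ε.num.toNat) + 1, ∃ w < I.ℓ ^ ((I.k - 1) * I.ℓ),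
          ∃ t < (I.k - 1) * I.ℓ + 1,
            v = I.chosen (j * W) W (I.k * (ε.den / ε.num.toNat)) w t) (I.input ε) := by
  have h0 := I.loaded_input ε
  have h5 : (I.input ε).reg 5 = ε.num.toNat := rfl
  have h6 : (I.input ε).reg 6 = ε.den := rfl
  have h3 : (I.input ε).arr 3 = fun _ => 0 := rfl
  have hnum : 0 < ε.num.toNat := by
    have := Rat.num_pos.2 hε
    omega
  generalize I.input ε = σ at h0 h5 h6 h3
  simp only [algorithm, wp, Expr.eval]
  have hσ : I.Loaded (σ.setReg 40 (σ.reg 6)) := h0.setReg (by omega)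
  refine wp_divide (by simp) (by simp) (by simp) (by simp) (by simp) (by simp) (by simp)
    (by simp) (by simp) (by rw [hσ.n]; exact hn) (by simpa [h5] using hnum)
    fun τ hF h41 _ => ?_
  rw [hσ.n] at h41
  simp only [State.setReg_reg, Nat.reduceEqDiff, if_false, if_true, h5, h6] at h41
  have hτ : I.Loaded τ := hσ.frame hF
  have e3 : τ.arr 3 = fun _ => 0 := (hF.arr 3 rfl).trans h3
  set m := ε.den / ε.num.toNat
  rw [hτ.n, hτ.k, h41]
  refine ⟨fun h => wp_outputAll hτ hn fun ρ hρ => Or.inl ⟨Or.inl (by omega), hρ⟩, fun h => ?_⟩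
  refine ⟨fun h => wp_outputAll hτ hn fun ρ hρ => Or.inl ⟨Or.inr (Or.inl (by omega)), hρ⟩,
    fun h' => ?_⟩
  replace h41 : τ.reg 41 = m := by omega
  refine wp_mul (by simp) (by simp) (by simp) (by simp) (by simp) (by simp; omega)
    fun ρ hG h44 => ?_
  have hρ : I.Loaded ρ := (hτ.setReg (by omega)).frame hG
  have f41 : ρ.reg 41 = m := (hG.reg 41 rfl).trans h41
  have f3 : ρ.arr 3 = fun _ => 0 := (hG.arr 3 rfl).trans e3
  simp only [State.setReg_reg, Nat.reduceEqDiff, if_false, if_true, hτ.ℓ] at h44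
  rw [hρ.n, h44]
  refine ⟨fun h => wp_outputAll hρ hn fun ρ hρ =>
    Or.inl ⟨Or.inr (Or.inr (Or.inl (by omega))), hρ⟩, fun h'' => ?_⟩
  refine wp_cappedPow hρ hn (by omega) fun μ hH h35 => ?_
  have hμ : I.Loaded μ := hρ.frame hH
  rw [h44] at h35
  rw [hμ.n]
  refine ⟨fun h => wp_outputAll hμ hn fun ρ hρ =>
    Or.inl ⟨Or.inr (Or.inr (Or.inr (by omega))), hρ⟩, fun h''' => ?_⟩
  replace h35 : μ.reg 35 = I.ℓ ^ ((I.k - 1) * I.ℓ) := by omega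
  refine wp_mul (by simp) (by simp) (by simp) (by simp) (by simp) (by rw [hμ.k]; omega)
    fun ν hJ h14 => ?_
  have hν : I.Loaded ν := hμ.frame hJ
  rw [hμ.k, (hH.reg 41 rfl).trans f41] at h14
  refine wp_maxSingle hν hn hs fun κ hM hW => ?_
  have hκ : I.Loaded κ := hν.frame hM
  have k14 : κ.reg 14 = I.k * m := (hM.reg 14 rfl).trans h14
  have k35 : κ.reg 35 = I.ℓ ^ ((I.k - 1) * I.ℓ) :=
    ((hM.reg 35 rfl).trans (hJ.reg 35 rfl)).trans h35
  have k44 : κ.reg 44 = (I.k - 1) * I.ℓ :=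
    (((hM.reg 44 rfl).trans (hJ.reg 44 rfl)).trans (hH.reg 44 rfl)).trans h44
  have k3 : κ.arr 3 = fun _ => 0 :=
    (((hM.arr 3 rfl).trans (hJ.arr 3 rfl)).trans (hH.arr 3 rfl)).trans f3
  -- The number of profit classes is `k * m + 1`; this is why `N` has to be at least `n ^ 2`.
  have hkm : I.k * m < I.n * I.n :=
    Nat.mul_lt_mul_of_lt_of_le (by omega) (by omega) (by omega)
  refine wp_followClasses ((hκ.setReg (by omega)).setReg (by omega)) hn hs
    (by simp [k44]; omega) (by simp [k14]; omega) (by simp [k35]; omega)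
    (by simp [k14]; omega) fun ξ _ h3 => Or.inr ⟨_, hW, ?_⟩
  simpa [k14, k35, k44, k3] using h3

end BMInstance

/-! ### Correctness of the search tree: spanned independent sets and the exchange element. -/

namespace BMInstance
open RAM

theorem cheapest_spec (I : BMInstance) (lo W K : ℕ) (A : Finset (ℕ × ℕ)) {j : ℕ} (hj : j ≤ I.n) :
    (I.cheapest lo W K A j = I.n ∧ ∀ e < j, ¬ I.Candidate lo W K A e) ∨
      (I.cheapest lo W K A j < I.n ∧ I.Candidate lo W K A (I.cheapest lo W K A j) ∧
        ∀ e < j, I.Candidate lo W K A e → I.costN (I.cheapest lo W K A j) ≤ I.costN e) := by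
  induction j with
  | zero => simp [cheapest]
  | succ j ih =>
    rw [cheapest]
    split_ifs with h
    · refine Or.inr ⟨by omega, h.1, fun e he hc => ?_⟩
      rcases Nat.lt_succ_iff_lt_or_eq.1 he with he | rfl
      · rcases ih (by omega) with ⟨_, h2⟩ | ⟨h1, _, h3⟩
        · exact absurd hc (h2 e he)
        · have := h3 e he hc
          omega
      · exact le_rfl
    · rcases ih (by omega) with ⟨h1, h2⟩ | ⟨h1, h2, h3⟩
      · refine Or.inl ⟨h1, fun e he hc => ?_⟩
        rcases Nat.lt_succ_iff_lt_or_eq.1 he with he | rfl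
        · exact h2 e he hc
        · exact h ⟨hc, Or.inl h1.ge⟩
      · refine Or.inr ⟨h1, h2, fun e he hc => ?_⟩
        rcases Nat.lt_succ_iff_lt_or_eq.1 he with he | rfl
        · exact h3 e he hc
        · exact not_lt.1 fun h' => h ⟨hc, Or.inr h'⟩

open Classical in
theorem select_count {p : ℕ → Prop} {i s j : ℕ} (hp : p i) (hij : i < j) :
    select p (Nat.count p i) s j = i := by
  induction j with
  | zero => omega
  | succ j ih =>
    rw [select]
    rcases Nat.lt_succ_iff_lt_or_eq.1 hij with h | rfl
    · rw [if_neg, ih h]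
      rintro ⟨_, h'⟩
      have h1 := Nat.count_strict_mono hp h
      omega
    · rw [if_pos ⟨hp, rfl⟩]

theorem select_of_forall_not {p : ℕ → Prop} {d s j : ℕ} (hp : ∀ i < j, ¬ p i) :
    select p d s j = s := by
  induction j with
  | zero => rfl
  | succ j ih => rw [select, if_neg fun h => hp j (by omega) h.1, ih fun i hi => hp i (by omega)]

/-- The matroids of the instance, followed by the free matroid on the elements that belong to none
of them. -/
noncomputable def matroid (I : BMInstance) (i : ℕ) : Matroid (Fin I.n) :=
  if h : i < I.s then I.M ⟨i, h⟩ else Matroid.freeOn {e : Fin I.n | ∀ i < I.s, ¬ I.Inc e i}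

theorem matroid_of_lt (I : BMInstance) {i : ℕ} (h : i < I.s) : I.matroid i = I.M ⟨i, h⟩ :=
  dif_pos h

theorem matroid_self (I : BMInstance) :
    I.matroid I.s = Matroid.freeOn {e : Fin I.n | ∀ i < I.s, ¬ I.Inc e i} :=
  dif_neg (lt_irrefl _)

theorem inc_iff (I : BMInstance) {i : ℕ} (h : i < I.s) (e : Fin I.n) :
    I.Inc e i ↔ e ∈ (I.matroid i).E := by
  rw [I.matroid_of_lt h]
  constructor
  · rintro ⟨e', i', h1, h2, h3⟩
    obtain rfl := Fin.ext h1
    subst h2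
    exact h3
  · exact fun he => ⟨e, ⟨i, h⟩, rfl, rfl, he⟩

theorem mem_matroid_self (I : BMInstance) (e : Fin I.n) :
    e ∈ (I.matroid I.s).E ↔ ∀ i < I.s, ¬ I.Inc e i := by
  rw [matroid_self]; rfl

/-- This is what the additional free matroid is for: a chosen element always has a matroid in which
it can be recorded, even if it belongs to no matroid of the instance. -/
theorem exists_mem_matroid (I : BMInstance) (e : Fin I.n) : ∃ i ≤ I.s, e ∈ (I.matroid i).E := by
  by_cases h : ∀ i < I.s, ¬ I.Inc e i
  · exact ⟨I.s, le_rfl, (I.mem_matroid_self e).2 h⟩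
  · push Not at h
    obtain ⟨i, hi, h⟩ := h
    exact ⟨i, hi.le, (I.inc_iff hi e).1 h⟩

open Classical in
theorem card_inc_le (I : BMInstance) (e : Fin I.n) :
    ((Finset.range I.s).filter (I.Inc e)).card ≤ I.ℓ := by
  refine le_trans ?_ (I.matchoid e)
  rw [Set.ncard_eq_toFinset_card', ← Finset.card_map Fin.valEmbedding]
  refine Finset.card_le_card fun i hi => ?_
  obtain ⟨hi, hinc⟩ := Finset.mem_filter.1 hi
  have hi := Finset.mem_range.1 hi
  rw [I.inc_iff hi, I.matroid_of_lt hi] at hinc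
  exact Finset.mem_map.2 ⟨⟨i, hi⟩, by simpa using hinc, rfl⟩

-- The free matroid contains only elements of no other matroid. Each of them is thus counted once,
-- and `1 ≤ ℓ`, so the matchoid parameter does not grow.
open Classical in
theorem card_mem_matroid_le (I : BMInstance) (e : Fin I.n) :
    ((Finset.range (I.s + 1)).filter fun i => e ∈ (I.matroid i).E).card ≤ I.ℓ := by
  have hfilter : ((Finset.range I.s).filter fun i => e ∈ (I.matroid i).E) =
      (Finset.range I.s).filter (I.Inc e) :=
    Finset.filter_congr fun i hi => (I.inc_iff (Finset.mem_range.1 hi) e).symm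
  rw [Finset.range_add_one, Finset.filter_insert, hfilter, I.mem_matroid_self]
  split_ifs with h
  · rw [Finset.filter_false_of_mem fun i hi => h i (Finset.mem_range.1 hi)]
    simpa using Nat.succ_le_of_lt I.ℓ_pos
  · exact I.card_inc_le e

/-- Every matroid containing `x` is selected by some digit. -/
theorem exists_select_eq (I : BMInstance) {x : Fin I.n} {i : ℕ} (hi : i ≤ I.s)
    (hx : x ∈ (I.matroid i).E) : ∃ d < I.ℓ, select (I.Inc x) d I.s I.s = i := by
  classical
  rcases hi.lt_or_eq with hi | rfl
  · rw [← I.inc_iff hi] at hx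
    refine ⟨_, lt_of_lt_of_le ?_ (I.card_inc_le x), select_count hx hi⟩
    rw [← Nat.count_eq_card_filter_range]
    convert Nat.count_strict_mono hx hi
  · exact ⟨0, I.ℓ_pos, select_of_forall_not ((I.mem_matroid_self x).1 hx)⟩

/-- Every subset of its ground set is independent in the free matroid, so it imposes no constraint.
-/
theorem feasible_iff (I : BMInstance) (S : Finset (Fin I.n)) :
    I.Feasible S ↔ ∀ i ≤ I.s, (I.matroid i).Indep ((S : Set (Fin I.n)) ∩ (I.matroid i).E) := by
  constructor
  · intro h i hi
    rcases hi.lt_or_eq with hi | rfl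
    · rw [I.matroid_of_lt hi]
      exact h ⟨i, hi⟩
    · rw [I.matroid_self]
      exact Matroid.freeOn_indep Set.inter_subset_right
  · intro h i
    have := h i i.2.le
    rwa [I.matroid_of_lt i.2] at this

theorem Feasible.subset {I : BMInstance} {S T : Finset (Fin I.n)} (h : I.Feasible T)
    (hST : S ⊆ T) : I.Feasible S :=
  fun i => (h i).subset (Set.inter_subset_inter_left _ (by exact_mod_cast hST))

/-- The set that `A` describes for the `i`-th matroid. -/
def slice (I : BMInstance) (A : Finset (ℕ × ℕ)) (i : ℕ) : Set (Fin I.n) :=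
  {v | ((v : ℕ), i) ∈ A}

/-- `A` describes independent sets that are spanned by `T`. -/
structure SpannedBy (I : BMInstance) (T : Finset (Fin I.n)) (A : Finset (ℕ × ℕ)) : Prop where
  lt : ∀ p ∈ A, p.1 < I.n
  le : ∀ p ∈ A, p.2 ≤ I.s
  indep : ∀ i ≤ I.s, (I.matroid i).Indep (I.slice A i)
  subset : ∀ i ≤ I.s, I.slice A i ⊆ (I.matroid i).closure T

theorem spannedBy_empty (I : BMInstance) (T : Finset (Fin I.n)) : I.SpannedBy T ∅ := by
  constructor <;> simp [slice]

/-- The slice for matroid `i` is independent and lies in the closure of `T`, so its size is at most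
the rank of `T ∩ E i`, hence at most `|T ∩ E i|`. In the sum over `i` each element of `T` is counted
at most `ℓ` times. This bounds the depth of the search. -/
theorem SpannedBy.card_le {I : BMInstance} {T : Finset (Fin I.n)} {A : Finset (ℕ × ℕ)}
    (h : I.SpannedBy T A) : A.card ≤ T.card * I.ℓ := by
  classical
  have hmaps : ∀ p ∈ A, p.2 ∈ Finset.range (I.s + 1) := fun p hp => by
    have := h.le p hp
    simp; omega
  rw [Finset.card_eq_sum_card_fiberwise hmaps]
  calc ∑ i ∈ Finset.range (I.s + 1), (A.filter fun p => p.2 = i).card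
      ≤ ∑ i ∈ Finset.range (I.s + 1), (T.filter fun v => v ∈ (I.matroid i).E).card := by
        refine Finset.sum_le_sum fun i hi => ?_
        have hi : i ≤ I.s := by simpa [Nat.lt_succ_iff] using hi
        have h1 : (A.filter fun p => p.2 = i).card ≤
            (Finset.univ.filter fun v : Fin I.n => ((v : ℕ), i) ∈ A).card := by
          rw [← Finset.card_image_of_injective (f := fun v : Fin I.n => ((v : ℕ), i)) _
            fun u v huv => Fin.ext (Prod.mk.inj huv).1]
          refine Finset.card_le_card ?_
          rintro ⟨v, j⟩ hp
          obtain ⟨hpA, rfl : j = i⟩ := Finset.mem_filter.1 hp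
          exact Finset.mem_image.2 ⟨⟨v, h.lt (v, j) hpA⟩, by simpa using hpA, rfl⟩
        refine h1.trans ?_
        have h2 := (h.indep i hi).encard_le_eRk_of_subset (h.subset i hi)
        rw [Matroid.eRk_closure_eq, ← Matroid.eRk_inter_ground] at h2
        have h3 := h2.trans ((I.matroid i).eRk_le_encard _)
        have h4 : I.slice A i = ((Finset.univ.filter fun v : Fin I.n => ((v : ℕ), i) ∈ A :
            Finset (Fin I.n)) : Set (Fin I.n)) := by ext; simp [slice]
        have h5 : (T : Set (Fin I.n)) ∩ (I.matroid i).E =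
            ((T.filter fun v => v ∈ (I.matroid i).E : Finset (Fin I.n)) : Set (Fin I.n)) := by
          ext; simp
        rw [h4, h5, Set.encard_coe_eq_coe_finsetCard, Set.encard_coe_eq_coe_finsetCard] at h3
        exact_mod_cast h3
    _ = ∑ v ∈ T, ((Finset.range (I.s + 1)).filter fun i => v ∈ (I.matroid i).E).card := by
        simp only [Finset.card_filter]
        exact Finset.sum_comm
    _ ≤ ∑ _v ∈ T, I.ℓ := Finset.sum_le_sum fun v _ => I.card_mem_matroid_le v
    _ = T.card * I.ℓ := by simp

theorem slice_insert (I : BMInstance) (A : Finset (ℕ × ℕ)) (x : Fin I.n) (i j : ℕ) :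
    I.slice (insert ((x : ℕ), i) A) j = if j = i then insert x (I.slice A j) else I.slice A j := by
  ext v
  split_ifs with h <;> simp [slice, h, Fin.ext_iff]

theorem unspanned_iff (I : BMInstance) (A : Finset (ℕ × ℕ)) (x : Fin I.n) :
    I.Unspanned A x ↔ (∀ i, ((x : ℕ), i) ∉ A) ∧
      ∀ i < I.s, x ∈ (I.matroid i).E → (I.matroid i).Indep (insert x (I.slice A i)) := by
  refine and_congr_right fun _ => forall_congr' fun i => forall_congr' fun hi => ?_
  rw [I.inc_iff hi]
  refine imp_congr_right fun _ => ?_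
  rw [oracle, I.matroid_of_lt hi]
  have : {e : Fin I.n | (e : ℕ) ∈ {v : ℕ | v = x ∨ (v, i) ∈ A}} = insert x (I.slice A i) := by
    ext v; simp [slice, Fin.ext_iff]
  simp only [this, hi, exists_true_left]

/-- Since `T` together with `e` is feasible, `e` is outside the closure of `T` in every matroid. It
is therefore outside the closure of every slice, which is contained in the closure of `T`. So `e`
remains a candidate as long as the sets are spanned by `T`. -/
theorem unspanned_of_feasible_insert {I : BMInstance} {T : Finset (Fin I.n)}
    {A : Finset (ℕ × ℕ)} (h : I.SpannedBy T A) {e : Fin I.n} (he : e ∉ T)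
    (hTe : I.Feasible (insert e T)) : I.Unspanned A e := by
  have hT := (I.feasible_iff _).1 (hTe.subset (Finset.subset_insert e T))
  rw [I.feasible_iff] at hTe
  have key : ∀ i ≤ I.s, e ∉ (I.matroid i).closure T := by
    intro i hi hcl
    have heE := Matroid.mem_ground_of_mem_closure hcl
    have hins := hTe i hi
    rw [Finset.coe_insert, Set.insert_inter_of_mem heE] at hins
    rw [← Matroid.closure_inter_ground, (hT i hi).mem_closure_iff'] at hcl
    exact he (by simpa using (hcl.2 hins).1)
  refine (I.unspanned_iff A e).2 ⟨fun i hi => key i (h.le _ hi) (h.subset i (h.le _ hi) hi),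
    fun i hi heE => ?_⟩
  rw [(h.indep i hi.le).insert_indep_iff]
  exact Or.inl ⟨heE, fun hcl => key i hi.le
    ((I.matroid i).closure_subset_closure_of_subset_closure (h.subset i hi.le) hcl)⟩

/-- An unspanned element that cannot be added to `T` extends one of the sets described by `A`. -/
theorem SpannedBy.exists_insert {I : BMInstance} {T : Finset (Fin I.n)} {A : Finset (ℕ × ℕ)}
    (h : I.SpannedBy T A) (hT : I.Feasible T) {x : Fin I.n} (hx : I.Unspanned A x)
    (hTx : ¬ (x ∉ T ∧ I.Feasible (insert x T))) :
    ∃ i ≤ I.s, x ∈ (I.matroid i).E ∧ I.SpannedBy T (insert ((x : ℕ), i) A) := by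
  obtain ⟨i, hi, hxE, hcl⟩ : ∃ i ≤ I.s, x ∈ (I.matroid i).E ∧ x ∈ (I.matroid i).closure T := by
    -- A candidate may belong to `T` itself. Then it is spanned in any matroid containing it;
    -- otherwise the matroid whose independence is violated spans it.
    by_cases hxT : x ∈ T
    · obtain ⟨i, hi, hxE⟩ := I.exists_mem_matroid x
      exact ⟨i, hi, hxE, Matroid.mem_closure_of_mem' _ (by simpa using hxT) hxE⟩
    · have hnot : ¬ I.Feasible (insert x T) := fun h' => hTx ⟨hxT, h'⟩
      rw [I.feasible_iff] at hnot hT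
      push Not at hnot
      obtain ⟨i, hi, hdep⟩ := hnot
      have hxE : x ∈ (I.matroid i).E := by
        by_contra hxE
        rw [Finset.coe_insert, Set.insert_inter_of_notMem hxE] at hdep
        exact hdep (hT i hi)
      rw [Finset.coe_insert, Set.insert_inter_of_mem hxE] at hdep
      refine ⟨i, hi, hxE, ?_⟩
      rw [← Matroid.closure_inter_ground, (hT i hi).mem_closure_iff']
      exact ⟨hxE, fun h' => absurd h' hdep⟩
  obtain ⟨hnew, hx⟩ := (I.unspanned_iff A x).1 hx
  refine ⟨i, hi, hxE, ⟨?_, ?_, ?_, ?_⟩⟩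
  · simpa using h.lt
  · simpa [hi] using h.le
  · intro j hj
    rw [slice_insert]
    split_ifs with hji
    · subst hji
      -- For a matroid of the instance, independence is what the oracle test has checked; in the
      -- free matroid nothing has to be checked.
      rcases hi.lt_or_eq with hi' | rfl
      · exact hx j hi' hxE
      · have hs := h.indep I.s le_rfl
        rw [matroid_self] at hs hxE ⊢
        exact Matroid.freeOn_indep (Set.insert_subset hxE hs.subset_ground)
    · exact h.indep j hj
  · intro j hj
    rw [slice_insert]
    split_ifs with hji
    · subst hji
      exact Set.insert_subset hcl (h.subset j hj)
    · exact h.subset j hj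

/-- If `e` can be added to `T`, then some branch chooses an element of the same profit class that
can be added to `T` and is not more expensive. -/
theorem SpannedBy.exists_branch {I : BMInstance} {T : Finset (Fin I.n)} {lo W K : ℕ}
    {e : Fin I.n} (he : e ∉ T) (hTe : I.Feasible (insert e T)) (hlo : lo ≤ K * I.profit e)
    (hW : K * I.profit e < lo + W) {D : ℕ} (hD : T.card * I.ℓ ≤ D) (r : ℕ)
    {A : Finset (ℕ × ℕ)} (h : I.SpannedBy T A) (hr : A.card + r = D) :
    ∃ w < I.ℓ ^ r, ∃ t ≤ r, ∃ x : Fin I.n,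
      (x : ℕ) = I.cheapest lo W K ((I.step lo W K)^[t] (A, w)).1 I.n ∧
      x ∉ T ∧ I.Feasible (insert x T) ∧ I.cost x ≤ I.cost e ∧
      lo ≤ K * I.profit x ∧ K * I.profit x < lo + W := by
  have hval : ∀ x : Fin I.n, I.profitN x = I.profit x ∧ I.costN x = I.cost x := fun x => by
    simp [profitN, costN]
  -- One node of the tree: `e` is a candidate, so the cheapest candidate exists and costs no more
  -- than `e`. Either it solves the exchange problem, or it enlarges `A` by a new pair that is still
  -- spanned by `T`.
  have key : ∀ A, I.SpannedBy T A → ∃ x : Fin I.n, (x : ℕ) = I.cheapest lo W K A I.n ∧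
      (∀ i, ((x : ℕ), i) ∉ A) ∧
      ((x ∉ T ∧ I.Feasible (insert x T) ∧ I.cost x ≤ I.cost e ∧ lo ≤ K * I.profit x ∧
        K * I.profit x < lo + W) ∨
      ∃ i ≤ I.s, x ∈ (I.matroid i).E ∧ I.SpannedBy T (insert ((x : ℕ), i) A)) := by
    intro A h
    have hcand : I.Candidate lo W K A e :=
      ⟨by rwa [(hval e).1], by rwa [(hval e).1], unspanned_of_feasible_insert h he hTe⟩
    rcases I.cheapest_spec lo W K A le_rfl with ⟨_, hno⟩ | ⟨hlt, hc, hmin⟩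
    · exact absurd hcand (hno e e.2)
    obtain ⟨x, hx⟩ : ∃ x : Fin I.n, (x : ℕ) = I.cheapest lo W K A I.n := ⟨⟨_, hlt⟩, rfl⟩
    rw [← hx] at hc hmin
    refine ⟨x, hx, hc.2.2.1, ?_⟩
    by_cases hdone : x ∉ T ∧ I.Feasible (insert x T)
    · refine Or.inl ⟨hdone.1, hdone.2, ?_, ?_, ?_⟩
      · simpa only [(hval _).2] using hmin e e.2 hcand
      · simpa only [(hval _).1] using hc.1
      · simpa only [(hval _).1] using hc.2.1
    · exact Or.inr (h.exists_insert (hTe.subset (Finset.subset_insert e T)) hc.2.2 hdone)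
  induction r generalizing A with
  | zero =>
    obtain ⟨x, hx, hnew, hdone | ⟨i, _, _, hins⟩⟩ := key A h
    · exact ⟨0, by simp, 0, le_rfl, x, hx, hdone⟩
    -- Already `A.card = D`, the largest size of a family spanned by `T`, so it cannot be enlarged.
    · have := hins.card_le
      rw [Finset.card_insert_of_notMem (hnew i)] at this
      omega
  | succ r ih =>
    obtain ⟨x, hx, hnew, hdone | ⟨i, hi, hxE, hins⟩⟩ := key A h
    -- The element chosen before the first step does not depend on the branch number, so `0` serves.
    · exact ⟨0, Nat.pow_pos I.ℓ_pos, 0, by omega, x, hx, hdone⟩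
    · obtain ⟨d, hd, hsel⟩ := I.exists_select_eq hi hxE
      obtain ⟨w, hw, t, ht, y, hy, hrest⟩ := ih hins
        (by rw [Finset.card_insert_of_notMem (hnew i)]; omega)
      -- The least significant digit is read first, so the digit `d` for the present node goes below
      -- the digits of `w`.
      refine ⟨d + I.ℓ * w, ?_, t + 1, by omega, y, ?_, hrest⟩
      · rw [pow_succ']
        calc d + I.ℓ * w < I.ℓ + I.ℓ * w := by omega
          _ = I.ℓ * (w + 1) := by ring
          _ ≤ I.ℓ * I.ℓ ^ r := Nat.mul_le_mul_left _ hw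
      · have hstep : I.step lo W K (A, d + I.ℓ * w) = (insert ((x : ℕ), i) A, w) := by
          simp only [step, ← hx, Nat.add_mul_mod_self_left, Nat.mod_eq_of_lt hd, hsel,
            Nat.add_mul_div_left _ _ I.ℓ_pos, Nat.div_eq_of_lt hd, zero_add]
        rw [Function.iterate_succ_apply, hstep, hy]

end BMInstance

/-! ### From the exchange property to a representative set. -/

namespace BMInstance
open RAM

theorem isSolution_empty (I : BMInstance) : I.IsSolution ∅ :=
  ⟨fun i => by simp, by simp, by simp⟩

theorem IsSolution.le_OPT {I : BMInstance} {S : Finset (Fin I.n)} (h : I.IsSolution S) :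
    ∑ e ∈ S, I.profit e ≤ I.OPT := by
  classical
  unfold OPT
  exact Finset.le_sup (f := fun S => ∑ e ∈ S, I.profit e) (by simpa using h)

theorem exists_isSolution_eq_OPT (I : BMInstance) :
    ∃ S, I.IsSolution S ∧ ∑ e ∈ S, I.profit e = I.OPT := by
  classical
  unfold OPT
  obtain ⟨S, hS, h⟩ := Finset.exists_mem_eq_sup
    ((Finset.univ : Finset (Finset (Fin I.n))).filter I.IsSolution)
    ⟨∅, by simpa using I.isSolution_empty⟩ fun S => ∑ e ∈ S, I.profit e
  exact ⟨S, by simpa using hS, h.symm⟩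

theorem IsSolution.single {I : BMInstance} {S : Finset (Fin I.n)} (h : I.IsSolution S)
    {e : Fin I.n} (he : e ∈ S) : I.Single e := by
  refine ⟨unspanned_of_feasible_insert (I.spannedBy_empty ∅) (by simp)
    (h.1.subset (by simpa using he)), ?_⟩
  simp only [costN, e.2, dif_pos]
  exact (Finset.single_le_sum (f := I.cost) (fun _ _ => Nat.zero_le _) he).trans h.2.2

theorem Single.isSolution {I : BMInstance} {e : Fin I.n} (h : I.Single e) :
    I.IsSolution {e} := by
  refine ⟨(I.feasible_iff _).2 fun i hi => ?_, by simpa using Nat.succ_le_of_lt I.k_pos, ?_⟩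
  · by_cases heE : e ∈ (I.matroid i).E
    · rcases hi.lt_or_eq with hi | rfl
      · have := ((I.unspanned_iff _ _).1 h.1).2 i hi heE
        exact this.subset fun v hv => Or.inl (by simpa using hv.1)
      · rw [matroid_self]
        exact Matroid.freeOn_indep Set.inter_subset_right
    · rw [Finset.coe_singleton, Set.singleton_inter_eq_empty.2 heE]
      exact Matroid.empty_indep _
  · simpa [costN] using h.2

/-- The width `W` of the profit classes is thus on the scale of the optimum, so that rounding errors
can be compared with it. -/
theorem IsMaxSingle.le_OPT {I : BMInstance} {W : ℕ} (h : I.IsMaxSingle W) : W ≤ I.OPT := by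
  rcases h.2 with h | ⟨e, he, hs, rfl⟩
  · omega
  · have hs : I.Single (⟨e, he⟩ : Fin I.n) := hs
    simpa [profitN, he] using hs.isSolution.le_OPT

/-- A solution can be exchanged, element by element, for one within a set that contains all
chosen elements. -/
theorem IsSolution.exists_subset {I : BMInstance} {R : Finset (Fin I.n)} {W K : ℕ}
    (hW : I.IsMaxSingle W)
    (hR : ∀ j < K + 1, ∀ w < I.ℓ ^ ((I.k - 1) * I.ℓ), ∀ t < (I.k - 1) * I.ℓ + 1,
      ∀ x : Fin I.n, (x : ℕ) = I.chosen (j * W) W K w t → x ∈ R)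
    {S : Finset (Fin I.n)} (hS : I.IsSolution S) :
    ∃ S' ⊆ R, I.IsSolution S' ∧
      K * ∑ e ∈ S, I.profit e ≤ K * ∑ e ∈ S', I.profit e + (S \ R).card * W := by
  induction hc : (S \ R).card generalizing S with
  | zero =>
    refine ⟨S, ?_, hS, by simp⟩
    rwa [Finset.card_eq_zero, Finset.sdiff_eq_empty_iff_subset] at hc
  | succ c ih =>
    obtain ⟨e, he⟩ : (S \ R).Nonempty := Finset.card_pos.1 (by omega)
    obtain ⟨heS, heR⟩ := Finset.mem_sdiff.1 he
    have hpe : I.profit e ≤ W := by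
      simpa [profitN] using hW.1 e e.2 (hS.single heS)
    have hWpos : 0 < W := (I.profit_pos e).trans_le hpe
    -- The class of `e` has index `⌊K p(e) / W⌋`, which is at most `K` because `p(e) ≤ W`; hence `K
    -- + 1` classes.
    have hj : K * I.profit e / W < K + 1 := by
      rw [Nat.lt_succ_iff]
      exact Nat.div_le_of_le_mul (by rw [mul_comm W]; exact Nat.mul_le_mul_left _ hpe)
    have hins : insert e (S.erase e) = S := Finset.insert_erase heS
    have hcard : (S.erase e).card = S.card - 1 := Finset.card_erase_of_mem heS
    have hSk := hS.2.1
    obtain ⟨w, hw, t, ht, x, hx, hxT, hfeas, hcost, hlo, _⟩ :=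
      SpannedBy.exists_branch (I := I) (T := S.erase e) (e := e)
        (lo := K * I.profit e / W * W) (W := W) (K := K) (by simp) (by rw [hins]; exact hS.1)
        (Nat.div_mul_le_self _ _) (Nat.lt_div_mul_add hWpos)
        (D := (I.k - 1) * I.ℓ) (Nat.mul_le_mul_right _ (by omega)) ((I.k - 1) * I.ℓ)
        (I.spannedBy_empty _) (by simp)
    have hxR : x ∈ R := hR _ hj w hw t (by omega) x hx
    have hSpos : 0 < S.card := Finset.card_pos.2 ⟨e, heS⟩
    have hsum : ∀ f : Fin I.n → ℕ, ∑ v ∈ insert x (S.erase e), f v + f e =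
        f x + ∑ v ∈ S, f v := fun f => by
      rw [Finset.sum_insert hxT, add_assoc, Finset.sum_erase_add _ _ heS]
    have hsol : I.IsSolution (insert x (S.erase e)) := by
      refine ⟨hfeas, ?_, ?_⟩
      · rw [Finset.card_insert_of_notMem hxT]; omega
      · have := hsum I.cost
        have := hS.2.2
        omega
    -- The new element is in `R`, so each exchange lowers the number of elements outside `R` by one.
    have hdiff : insert x (S.erase e) \ R = (S \ R).erase e := by
      rw [Finset.insert_sdiff_of_mem _ hxR, Finset.erase_sdiff_comm]
    obtain ⟨S', hS'R, hS', hle⟩ := ih hsol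
      (by rw [hdiff, Finset.card_erase_of_mem he]; omega)
    refine ⟨S', hS'R, hS', ?_⟩
    have h1 := congrArg (K * ·) (hsum I.profit)
    simp only [mul_add] at h1
    -- Both `K * p(e)` and `K * p(x)` lie in one interval of length `W`, so this exchange loses less
    -- than `W` on the scale of `K`.
    have h2 : K * I.profit e < K * I.profit e / W * W + W := Nat.lt_div_mul_add hWpos
    rw [Nat.succ_mul]
    omega

/-- At most `k` exchanges lose at most `k * W ≤ k * OPT` on the scale `K = k * m`. Cancelling `k`
leaves `m * OPT ≤ m * p + OPT`, a loss of `OPT / m ≤ 2 * ε * OPT`. -/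
theorem isRepresentative_of_chosen {I : BMInstance} {R : Finset (Fin I.n)} {W m : ℕ} {ε : ℝ}
    (hm : 0 < m) (hmε : 1 ≤ 2 * ε * m) (hW : I.IsMaxSingle W)
    (hR : ∀ j < I.k * m + 1, ∀ w < I.ℓ ^ ((I.k - 1) * I.ℓ), ∀ t < (I.k - 1) * I.ℓ + 1,
      ∀ x : Fin I.n, (x : ℕ) = I.chosen (j * W) W (I.k * m) w t → x ∈ R) :
    I.IsRepresentative ε R := by
  obtain ⟨S, hS, hopt⟩ := I.exists_isSolution_eq_OPT
  obtain ⟨S', hS'R, hS', hle⟩ := hS.exists_subset hW hR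
  refine ⟨S', hS', hS'R, ?_⟩
  rw [hopt] at hle
  generalize ∑ e ∈ S', I.profit e = p at *
  have h1 : (S \ R).card * W ≤ I.k * I.OPT :=
    Nat.mul_le_mul ((Finset.card_le_card Finset.sdiff_subset).trans hS.2.1) hW.le_OPT
  have h2 : I.k * (m * I.OPT) ≤ I.k * (m * p + I.OPT) := by
    rw [mul_add, ← mul_assoc, ← mul_assoc]; omega
  have h3 : m * I.OPT ≤ m * p + I.OPT := Nat.le_of_mul_le_mul_left h2 I.k_pos
  have h4 : (m : ℝ) * I.OPT ≤ m * p + I.OPT := by exact_mod_cast h3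
  have h5 : (I.OPT : ℝ) ≤ 2 * ε * m * I.OPT :=
    le_mul_of_one_le_left (Nat.cast_nonneg _) hmε
  have hm' : (0 : ℝ) < m := by exact_mod_cast hm
  refine le_of_mul_le_mul_left ?_ hm'
  linarith

theorem isRepresentative_univ (I : BMInstance) {ε : ℝ} (hε : 0 ≤ ε) :
    I.IsRepresentative ε Finset.univ := by
  obtain ⟨S, hS, hopt⟩ := I.exists_isSolution_eq_OPT
  refine ⟨S, hS, Finset.subset_univ _, ?_⟩
  rw [hopt]
  have : (0 : ℝ) ≤ ε * I.OPT := by positivity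
  linarith

/-! ### Estimates for the size of the output. -/

section sizeBound

variable (I : BMInstance) {ε : ℝ}

theorem four_mul_pow_le_sizeBound (hε : 0 < ε) (hε' : ε < 1 / 2) :
    4 * (I.ℓ : ℝ) ^ ((I.k - 1) * I.ℓ) ≤ I.sizeBound ε := by
  have hk : (1 : ℝ) ≤ I.k := by exact_mod_cast I.k_pos
  have hE : (2 : ℝ) ≤ ε⁻¹ := by
    rw [le_inv_comm₀ (by norm_num) hε]
    linarith
  have hL : (0 : ℝ) ≤ (I.ℓ : ℝ) ^ ((I.k - 1) * I.ℓ) := by positivity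
  have h1 : (1 : ℝ) ≤ (I.k : ℝ) ^ 2 := one_le_pow₀ hk
  have h2 : (4 : ℝ) ≤ ε⁻¹ ^ 2 := by nlinarith
  unfold sizeBound
  calc 4 * (I.ℓ : ℝ) ^ ((I.k - 1) * I.ℓ) = (I.ℓ : ℝ) ^ ((I.k - 1) * I.ℓ) * 1 * 4 := by ring
    _ ≤ _ := by gcongr

theorem one_le_pow_mul : (1 : ℝ) ≤ (I.ℓ : ℝ) ^ ((I.k - 1) * I.ℓ) :=
  one_le_pow₀ (by exact_mod_cast I.ℓ_pos)

/-- The second `ε⁻¹ ≥ 2` of the bound pays for the factor `2`. The last factor `k` on the left is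
room for the depth when `ℓ = 1`. -/
theorem mul_inv_mul_pow_le_sizeBound (hε : 0 < ε) (hε' : ε < 1 / 2) :
    2 * (I.k : ℝ) * ε⁻¹ * (I.ℓ : ℝ) ^ ((I.k - 1) * I.ℓ) * I.k ≤ I.sizeBound ε := by
  have hE : (2 : ℝ) ≤ ε⁻¹ := by
    rw [le_inv_comm₀ (by norm_num) hε]
    linarith
  unfold sizeBound
  calc 2 * (I.k : ℝ) * ε⁻¹ * (I.ℓ : ℝ) ^ ((I.k - 1) * I.ℓ) * I.k
      = (I.ℓ : ℝ) ^ ((I.k - 1) * I.ℓ) * (I.k : ℝ) ^ 2 * (2 * ε⁻¹) := by ring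
    _ ≤ (I.ℓ : ℝ) ^ ((I.k - 1) * I.ℓ) * (I.k : ℝ) ^ 2 * (ε⁻¹ * ε⁻¹) := by gcongr
    _ = _ := by ring

theorem one_le_log_sizeBound (hε : 0 < ε) (hε' : ε < 1 / 2) :
    1 ≤ Real.log (I.sizeBound ε) := by
  have h := I.four_mul_pow_le_sizeBound hε hε'
  have h1 := I.one_le_pow_mul
  rw [Real.le_log_iff_exp_le (by linarith)]
  have := Real.exp_one_lt_d9
  linarith

/-- For `ℓ ≥ 2` the bound is at least `2 ^ (D + 2)` with `D = (k - 1) * ℓ`, and `log 2 > 1 / 2`. -/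
theorem depth_le_log_sizeBound (hε : 0 < ε) (hε' : ε < 1 / 2) (hℓ : 2 ≤ I.ℓ) :
    (((I.k - 1) * I.ℓ + 1 : ℕ) : ℝ) ≤ 2 * Real.log (I.sizeBound ε) := by
  have h := I.four_mul_pow_le_sizeBound hε hε'
  have h2 : (2 : ℝ) ^ ((I.k - 1) * I.ℓ + 2) ≤ I.sizeBound ε := by
    refine le_trans ?_ h
    rw [pow_add, mul_comm]
    have : (2 : ℝ) ≤ I.ℓ := by exact_mod_cast hℓ
    norm_num
    gcongr
  have h3 := Real.log_le_log (by positivity) h2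
  rw [Real.log_pow] at h3
  have h4 := Real.log_two_gt_d9
  push_cast at h3 ⊢
  have h5 : (0 : ℝ) ≤ ((I.k - 1 : ℕ) : ℝ) * I.ℓ := by positivity
  nlinarith

theorem depth_lt : (I.k - 1) * I.ℓ < I.k * I.ℓ ^ ((I.k - 1) * I.ℓ) := by
  rcases Nat.lt_or_ge I.ℓ 2 with h | h
  · have : I.ℓ = 1 := by have := I.ℓ_pos; omega
    have := I.k_pos
    simp [*]
  · calc (I.k - 1) * I.ℓ < I.ℓ ^ ((I.k - 1) * I.ℓ) := Nat.lt_pow_self h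
      _ ≤ I.k * I.ℓ ^ ((I.k - 1) * I.ℓ) := Nat.le_mul_of_pos_left _ I.k_pos

theorem sizeBound_le_mul_log (hε : 0 < ε) (hε' : ε < 1 / 2) :
    I.sizeBound ε ≤ 2 * (I.sizeBound ε * Real.log (I.sizeBound ε) ^ 1) := by
  have h1 := I.one_le_log_sizeBound hε hε'
  have h2 := I.four_mul_pow_le_sizeBound hε hε'
  have h3 := I.one_le_pow_mul
  nlinarith

/-- The number of chosen elements is within the bound. -/
theorem mul_pow_mul_le {m : ℕ} (hε : 0 < ε) (hε' : ε < 1 / 2) (hm : m ≤ ε⁻¹) :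
    (((I.k * m + 1) * (I.ℓ ^ ((I.k - 1) * I.ℓ) * ((I.k - 1) * I.ℓ + 1)) : ℕ) : ℝ) ≤
      2 * (I.sizeBound ε * Real.log (I.sizeBound ε) ^ 1) := by
  have hk : (1 : ℝ) ≤ I.k := by exact_mod_cast I.k_pos
  have hE : (2 : ℝ) ≤ ε⁻¹ := by
    rw [le_inv_comm₀ (by norm_num) hε]
    linarith
  have hb := I.mul_inv_mul_pow_le_sizeBound hε hε'
  have hkm : (I.k : ℝ) * m + 1 ≤ 2 * I.k * ε⁻¹ := by
    have : (I.k : ℝ) * m ≤ I.k * ε⁻¹ := by gcongr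
    nlinarith
  have hL := I.one_le_pow_mul
  have hstep : (((I.k * m + 1) * (I.ℓ ^ ((I.k - 1) * I.ℓ) * ((I.k - 1) * I.ℓ + 1)) : ℕ) : ℝ) ≤
      2 * I.k * ε⁻¹ * (I.ℓ : ℝ) ^ ((I.k - 1) * I.ℓ) * (((I.k - 1) * I.ℓ + 1 : ℕ) : ℝ) := by
    rw [Nat.cast_mul, Nat.cast_mul, ← mul_assoc, Nat.cast_pow]
    gcongr
    exact_mod_cast hkm
  refine hstep.trans ?_
  -- For `ℓ = 1` the power is `1`, so no logarithm controls the depth; but `D + 1 = k`, and the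
  -- second factor `k` of the bound absorbs it. For `ℓ ≥ 2` the logarithm does.
  rcases Nat.lt_or_ge I.ℓ 2 with h | h
  · have hℓ : I.ℓ = 1 := by have := I.ℓ_pos; omega
    have hd : (I.k - 1) * I.ℓ + 1 = I.k := by have := I.k_pos; rw [hℓ]; omega
    rw [hd]
    exact hb.trans (I.sizeBound_le_mul_log hε hε')
  · have hd := I.depth_le_log_sizeBound hε hε' h
    have hlog := I.one_le_log_sizeBound hε hε'
    calc 2 * (I.k : ℝ) * ε⁻¹ * (I.ℓ : ℝ) ^ ((I.k - 1) * I.ℓ) * (((I.k - 1) * I.ℓ + 1 : ℕ) : ℝ)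
        ≤ 2 * (I.k : ℝ) * ε⁻¹ * (I.ℓ : ℝ) ^ ((I.k - 1) * I.ℓ) *
          (2 * Real.log (I.sizeBound ε)) := by gcongr
      _ ≤ I.sizeBound ε * (2 * Real.log (I.sizeBound ε)) := by
        gcongr
        refine le_trans ?_ hb
        exact le_mul_of_one_le_right (by positivity) hk
      _ = _ := by ring

/-- Each of the four quantities that trigger an exit is itself at most `2 * k * ε⁻¹ * ℓ ^ D * k`
with `D = (k - 1) * ℓ`, so outputting all `n` elements is within the bound. -/
theorem card_le_of_exit {m : ℕ} (hε : 0 < ε) (hε' : ε < 1 / 2) (hm : m ≤ ε⁻¹)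
    (h : I.n ≤ m ∨ I.n ≤ I.k ∨ I.n ≤ (I.k - 1) * I.ℓ ∨ I.n ≤ I.ℓ ^ ((I.k - 1) * I.ℓ)) :
    (I.n : ℝ) ≤ 2 * (I.sizeBound ε * Real.log (I.sizeBound ε) ^ 1) := by
  refine le_trans ?_ (I.sizeBound_le_mul_log hε hε')
  refine le_trans ?_ (I.mul_inv_mul_pow_le_sizeBound hε hε')
  have hk : (1 : ℝ) ≤ I.k := by exact_mod_cast I.k_pos
  have hE : (2 : ℝ) ≤ ε⁻¹ := by
    rw [le_inv_comm₀ (by norm_num) hε]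
    linarith
  have hL := I.one_le_pow_mul
  have hd : (((I.k - 1) * I.ℓ : ℕ) : ℝ) ≤ I.k * (I.ℓ : ℝ) ^ ((I.k - 1) * I.ℓ) := by
    exact_mod_cast I.depth_lt.le
  set L := (I.ℓ : ℝ) ^ ((I.k - 1) * I.ℓ) with hLdef
  have hkk : (1 : ℝ) ≤ I.k * I.k := by nlinarith
  have e1 : ε⁻¹ ≤ 2 * (I.k : ℝ) * ε⁻¹ * L * I.k := by
    calc ε⁻¹ = ε⁻¹ * 1 * 1 := by ring
      _ ≤ ε⁻¹ * (I.k * I.k) * L := by gcongr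
      _ ≤ 2 * (ε⁻¹ * (I.k * I.k) * L) := le_mul_of_one_le_left (by positivity) one_le_two
      _ = _ := by ring
  have e2 : (I.k : ℝ) * L ≤ 2 * (I.k : ℝ) * ε⁻¹ * L * I.k := by
    calc (I.k : ℝ) * L = I.k * L * 1 * 1 := by ring
      _ ≤ I.k * L * I.k * (2 * ε⁻¹) := by gcongr; linarith
      _ = _ := by ring
  rcases h with h | h | h | h
  · have : (I.n : ℝ) ≤ m := by exact_mod_cast h
    linarith
  · have : (I.n : ℝ) ≤ I.k := by exact_mod_cast h
    nlinarith
  · have : (I.n : ℝ) ≤ (((I.k - 1) * I.ℓ : ℕ) : ℝ) := by exact_mod_cast h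
    linarith
  · have : (I.n : ℝ) ≤ L := by rw [hLdef]; exact_mod_cast h
    nlinarith

end sizeBound

/-! ### Counting the output, rounding `1 / ε`, and the main theorem. -/

theorem card_output_le {I : BMInstance} {τ : State} {a b c : ℕ} {f : ℕ → ℕ → ℕ → ℕ}
    (h : ∀ v, τ.arr 3 v ≠ 0 ↔ ∃ j < a, ∃ w < b, ∃ t < c, v = f j w t) :
    (I.output τ).card ≤ a * (b * c) := by
  classical
  calc (I.output τ).card = ((I.output τ).map Fin.valEmbedding).card := (Finset.card_map _).symm
    _ ≤ ((Finset.range a ×ˢ (Finset.range b ×ˢ Finset.range c)).image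
          fun p => f p.1 p.2.1 p.2.2).card := by
        refine Finset.card_le_card fun v hv => ?_
        obtain ⟨e, he, rfl⟩ := Finset.mem_map.1 hv
        obtain ⟨j, hj, w, hw, t, ht, heq⟩ := (h e).1 (by simpa [output] using he)
        exact Finset.mem_image.2 ⟨(j, w, t), by simp [hj, hw, ht], heq.symm⟩
    _ ≤ a * (b * c) := Finset.card_image_le.trans (by simp)

theorem three_le_size (I : BMInstance) : 3 ≤ I.size := by
  have h1 := Nat.size_pos.2 I.budget_pos
  have h2 := Nat.size_pos.2 I.k_pos
  have h3 := Nat.size_pos.2 I.ℓ_pos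
  unfold size
  omega

end BMInstance

/-- The quotient is `⌊1/ε⌋`. As `1/ε ≥ 1`, rounding down loses at most half of the value, which is
where the factor `2` in `1 - 2ε` is used. -/
theorem Rat.den_div_num_bounds {ε : ℚ} (hε : 0 < ε) (hε' : ε < 1 / 2) :
    0 < ε.den / ε.num.toNat ∧ ((ε.den / ε.num.toNat : ℕ) : ℝ) ≤ (ε : ℝ)⁻¹ ∧
      1 ≤ 2 * (ε : ℝ) * ((ε.den / ε.num.toNat : ℕ) : ℝ) := by
  obtain ⟨a, ha⟩ : ∃ a : ℕ, ε.num = a := ⟨ε.num.toNat, by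
    rw [Int.toNat_of_nonneg (Rat.num_nonneg.2 hε.le)]⟩
  have hapos : 0 < a := by
    have := Rat.num_pos.2 hε
    omega
  have hεR : (ε : ℝ) = a / ε.den := by
    rw [Rat.cast_def, ha, Int.cast_natCast]
  rw [ha, Int.toNat_natCast]
  have hb : (0 : ℝ) < ε.den := by exact_mod_cast ε.den_pos
  have haR : (0 : ℝ) < a := by exact_mod_cast hapos
  have hab : a ≤ ε.den := by
    have h1 : (ε : ℝ) < 1 / 2 := by
      have : ((ε : ℚ) : ℝ) < ((1 / 2 : ℚ) : ℝ) := by exact_mod_cast hε'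
      simpa using this
    rw [hεR, div_lt_iff₀ hb] at h1
    have : (a : ℝ) ≤ ε.den := by linarith
    exact_mod_cast this
  have hpos : 0 < ε.den / a := Nat.div_pos hab hapos
  refine ⟨hpos, ?_, ?_⟩
  · rw [hεR, inv_div, le_div_iff₀ haR]
    exact_mod_cast Nat.div_mul_le_self ε.den a
  · rw [hεR]
    have h1 : ε.den < ε.den / a * a + a := Nat.lt_div_mul_add hapos
    have h2 : a ≤ ε.den / a * a := Nat.le_mul_of_pos_left _ hpos
    have h3 : (ε.den : ℝ) ≤ 2 * (((ε.den / a : ℕ) : ℝ) * a) := by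
      exact_mod_cast (by omega : ε.den ≤ 2 * (ε.den / a * a))
    rw [mul_div_assoc', div_mul_eq_mul_div, le_div_iff₀ hb]
    linarith

theorem mainTheorem2 :
    ∃ (P : RAM.Prog) (c : ℕ) (C : ℝ) (d : ℕ), ∀ (I : BMInstance) (ε : ℚ), 0 < ε → ε < 1 / 2 →
      ∃ (t : ℕ) (τ : RAM.State),
        RAM.Exec I.oracle P (I.input ε) t τ ∧
        t ≤ I.size ^ c ∧
        I.IsRepresentative (ε : ℝ) (I.output τ) ∧
        ((I.output τ).card : ℝ) ≤
          C * (I.sizeBound (ε : ℝ) * Real.log (I.sizeBound (ε : ℝ)) ^ d) := by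
  obtain ⟨c, hc⟩ := BMInstance.algorithm.exists_time_le_pow
  -- Loops have at most `N = |I| ^ 2` rounds, so the time `N ^ c` is `|I| ^ (2 * c)`. A single
  -- logarithm suffices, to absorb the depth of the search.
  refine ⟨BMInstance.algorithm, 2 * c, 2, 1, fun I ε hε hε' => ?_⟩
  have hsize := I.three_le_size
  have hn : I.n ≤ I.size := by unfold BMInstance.size; omega
  have hs : I.s ≤ I.size := by unfold BMInstance.size; omega
  have hsq : I.size ≤ I.size ^ 2 := Nat.le_self_pow (by omega) _
  obtain ⟨t, τ, hexec, ht, hτ⟩ := RAM.exec_of_wp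
    (I.wp_algorithm hε (N := I.size ^ 2) (hn.trans hsq)
      (by rw [sq]; exact Nat.mul_le_mul hn hn) (hs.trans hsq))
  refine ⟨t, τ, hexec, ?_, ?_⟩
  · rw [pow_mul]
    exact ht.trans (hc _ (by omega))
  have hεR : (0 : ℝ) < ε := by exact_mod_cast hε
  have hεR' : (ε : ℝ) < 1 / 2 := by
    have : ((ε : ℚ) : ℝ) < ((1 / 2 : ℚ) : ℝ) := by exact_mod_cast hε'
    simpa using this
  obtain ⟨hm, hm1, hm2⟩ := Rat.den_div_num_bounds hε hε'
  rcases hτ with ⟨hexit, hall⟩ | ⟨W, hW, hout⟩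
  · have huniv : I.output τ = Finset.univ := by
      ext e
      simpa [BMInstance.output] using hall e e.2
    rw [huniv]
    refine ⟨I.isRepresentative_univ hεR.le, ?_⟩
    rw [Finset.card_univ, Fintype.card_fin]
    exact I.card_le_of_exit hεR hεR' hm1 hexit
  · refine ⟨BMInstance.isRepresentative_of_chosen hm hm2 hW fun j hj w hw t ht x hx => ?_, ?_⟩
    · exact Finset.mem_filter.2 ⟨Finset.mem_univ _, (hout x).2 ⟨j, hj, w, hw, t, ht, hx⟩⟩
    · exact le_trans (by exact_mod_cast BMInstance.card_output_le hout)
        (I.mul_pow_mul_le hεR hεR' hm1)
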